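/- **Setting.** Let $d,p,q\ge 1$ and let $\sigma:\mathbb R\to\mathbb R$ be $L_\sigma$-Lipschitz with $\sigma(0)=0$, acting entrywise. Consider parameters $\theta=(\Phi,\mathbf A_1,\dots,\mathbf A_q,\mathbf b_1,\dots,\mathbf b_q,\mathbf U,v)$ with $\Phi,v\in\mathbb R^p$, $\mathbf U\in\mathbb R^{p\times d}$, $\mathbf A_h\in\mathbb R^{p\times p}$ and $\mathbf b_h\in\mathbb R^p$ for $h<q$, $\mathbf A_q:\mathbb R^p\to\mathbb R^{p\times d}$ linear and $\mathbf b_q\in\mathbb R^{p\times d}$. Let $\Theta$ be the set of those with $\|\Phi\|\le B_\Phi$, $\|\mathbf A_h\|\le B_{\mathbf A}$, $\|\mathbf b_h\|\le B_{\mathbf b}$ $(1\le h\le q)$, $\|\mathbf U\|\le B_{\mathbf U}$, $\|v\|\le B_v$ (Euclidean/Frobenius norms). Let $$\mathbf G_\psi(z)=\sigma(\mathbf A_q\,\sigma(\mathbf A_{q-1}\cdots\sigma(\mathbf A_1z+\mathbf b_1)\cdots+\mathbf b_{q-1})+\mathbf b_q)\in\mathbb R^{p\times d}.$$ Inputs are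 paths $x:[0,1]\to\mathbb R^d$ that are $L_x$-Lipschitz with $\|x_0\|\le B_x$, or their samples $\mathbf x^D=(x_{t_0},\dots,x_{t_K})$ on a grid $D=\{0=t_0<\dots<t_K=1\}$ with largest gap $|D|$. The class $\mathcal F^D_\Theta$ consists of the maps $\mathbf x^D\mapsto\Phi^\top z_{t_K}$, $\theta\in\Theta$, where $z_{t_0}=\sigma(\mathbf Ux_{0}+v)$ and $z_{t_{k+1}}=z_{t_k}+\mathbf G_\psi(z_{t_k})(x_{t_{k+1}}-x_{t_k})$. The class $\mathcal F_\Theta$ consists of the maps $x\mapsto\Phi^\top z_1$, $\theta\in\Theta$, where $z$ is the solution of $dz_t=\mathbf G_\psi(z_t)\,dx_t$ on $[0,1]$ (Riemann–Stieltjes) with $z_0=\sigma(\mathbf Ux_0+v)$. **Constants.** Put $\ell=(L_\sigma B_{\mathbf A})^q$, $\alpha_h=(L_\sigma B_{\mathbf A})^h$, $\beta_h=L_\sigma B_{\mathbf b}\sum_{j<h}(L_\sigma B_{\mathbf A})^j$ and $$R^D=\big(L_\sigma(B_{\mathbf U}B_x+B_v)+\beta_qL_x\big)(1+\ell L_x|D|)^K,\qquad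 R=\big(L_\sigma(B_{\mathbf U}B_x+B_v)+\beta_qL_x\big)e^{\ell L_x},$$ $M^D_\Theta=B_\Phi R^D$, $M_\Theta=B_\Phi R$, $C_q=8q+12$. For $\rho\ge0$ let $$C_{\mathbf A}(\rho)=B_\Phi L_xe^{\ell L_x}\max_{1\le i\le q}(L_\sigma B_{\mathbf A})^{q-i}L_\sigma(\alpha_{i-1}\rho+\beta_{i-1}),\quad C_{\mathbf b}=B_\Phi L_xe^{\ell L_x}\max_{1\le i\le q}(L_\sigma B_{\mathbf A})^{q-i}L_\sigma,$$ $$C_{\mathbf U}=B_\Phi B_xe^{\ell L_x}L_\sigma,\qquad C_v=B_\Phi e^{\ell L_x}L_\sigma,$$ $$K_1(\rho)=\max\{B_\Phi\rho,\;B_vC_v\},\quad K_2(\rho)=\max\{B_{\mathbf b}C_{\mathbf b},\;B_{\mathbf A}C_{\mathbf A}(\rho),\;B_{\mathbf U}C_{\mathbf U}\},\quad \overline K(\rho)=\max\{K_1(\rho),K_2(\rho)\},$$ and $K_i^D=K_i(R^D)$, $\overline K^D=\overline K(R^D)$, $K_i=K_i(R)$, $\overline K=\overline K(R)$. **Covering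 numbers.** Let $\mathcal N(\mathcal F,\eta)$ be the least cardinality of a subset $C\subseteq\mathcal F$ such that every element of $\mathcal F$ is within uniform distance $\eta$ (over the inputs above) of an element of $C$. For every $\eta>0$, $\mathcal N(\mathcal F^D_\Theta,\eta)$ is at most $$\Big(1+\tfrac{C_q\overline K^D}{2\eta}\sqrt p\Big)^{(q+1)p(1+p)}\Big(1+\tfrac{C_qK_2^D}{2\eta}(\sqrt p+\sqrt d)\Big)^{2dp}\Big(1+\tfrac{C_q\overline K^D}{2\eta}\sqrt{dp}\Big)^{dp^2}$$ and also at most $$\Big(1+\tfrac{C_qK_1^D}{2\eta}\Big)^{2p}\Big(1+\tfrac{C_qK_2^D}{2\eta}\sqrt p\Big)^{(q-1)p(1+p)}\Big(1+\tfrac{C_qK_2^D}{2\eta}\sqrt{dp}\Big)^{dp(2+p)}.$$ **Rademacher complexity.** Every $f\in\mathcal F^D_\Theta$ satisfies $|f|\le M^D_\Theta$ on the inputs. For every $n$ with $\sqrt n\,M^D_\Theta\ge1$ and $\sqrt n\,C_qK_2^D\ge2$ and every sample of size $n$ of inputs discretized on $D$, the empirical Rademacher complexity $\mathbb E_\varepsilon\sup_{f\in\mathcal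 F^D_\Theta}\frac1n\sum_i\varepsilon_if(\mathbf x^{D,i})$ is at most $$\frac4n+\frac{24M^D_\Theta}{\sqrt n}\sqrt{(q+1)p(p+1)\log(\sqrt n\,C_q\overline K^D)+2dp\log(\sqrt{np}\,C_qK_2^D)+dp^2\log(\sqrt{ndp}\,C_qK_2^D)}$$ and also at most $$\frac4n+\frac{24M^D_\Theta}{\sqrt n}\sqrt{2p\log(\sqrt n\,C_qK_1^D)+(q-1)p(p+1)\log(\sqrt{np}\,C_qK_2^D)+dp(2+p)\log(\sqrt{ndp}\,C_qK_2^D)}.$$ **Continuous inputs.** For every $\theta$ and every input path $x$, the controlled differential equation has exactly one solution on $[0,1]$, and all the statements above hold for $\mathcal F_\Theta$ with $M_\Theta,K_1,K_2,\overline K$ in place of $M^D_\Theta,K^D_1,K^D_2,\overline K^D$; these constants do not depend on any discretization. -/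

import Mathlib

open scoped NNReal ENNReal

namespace NCDE

noncomputable section

/-! ### Neural vector fields and initialization -/

/-- Parameters `θ = (Φ, ψ, ξ)` of an NCDE with input dimension `d`, latent dimension `p` and a
vector field of depth `q ≥ 1`: the first `q - 1` layers map `ℝ^p` to `ℝ^p`, the last one maps `ℝ^p`
to `ℝ^(p × d)`. -/
structure Params (d p q : ℕ) where
  /-- linear readout `Φ` -/
  readout : EuclideanSpace ℝ (Fin p)
  /-- `A_1, …, A_{q-1}` -/
  A : Fin (q - 1) → Matrix (Fin p) (Fin p) ℝ
  /-- `b_1, …, b_{q-1}` -/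
  b : Fin (q - 1) → EuclideanSpace ℝ (Fin p)
  /-- `A_q` -/
  Alast : Matrix (Fin p × Fin d) (Fin p) ℝ
  /-- `b_q` -/
  blast : Matrix (Fin p) (Fin d) ℝ
  /-- initialization weights `U` -/
  U : Matrix (Fin p) (Fin d) ℝ
  /-- initialization bias `v` -/
  v : EuclideanSpace ℝ (Fin p)

/-- Matrix-vector product, with Euclidean vectors. -/
def mulV {p d : ℕ} (A : Matrix (Fin p) (Fin d) ℝ) (x : EuclideanSpace ℝ (Fin d)) :
    EuclideanSpace ℝ (Fin p) :=
  WithLp.toLp 2 (A.mulVec x.ofLp)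

/-- A fully connected layer `z ↦ σ (A z + b)`, with `σ` acting entrywise. -/
def layer {p d : ℕ} (σ : ℝ → ℝ) (A : Matrix (Fin p) (Fin d) ℝ) (b : EuclideanSpace ℝ (Fin p))
    (z : EuclideanSpace ℝ (Fin d)) : EuclideanSpace ℝ (Fin p) :=
  WithLp.toLp 2 fun i => σ ((mulV A z + b) i)

variable {d p q : ℕ}

/-- Output of the first `q - 1` layers. -/
def Params.hidden (θ : Params d p q) (σ : ℝ → ℝ) (z : EuclideanSpace ℝ (Fin p)) :
    EuclideanSpace ℝ (Fin p) :=
  Fin.foldl (q - 1) (fun u h => layer σ (θ.A h) (θ.b h) u) z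

/-- The neural vector field
`G_ψ(z) = σ (A_q σ (A_{q-1} σ (⋯ σ (A_1 z + b_1)) + b_{q-1}) + b_q) ∈ ℝ^(p × d)`. -/
def Params.field (θ : Params d p q) (σ : ℝ → ℝ) (z : EuclideanSpace ℝ (Fin p)) :
    Matrix (Fin p) (Fin d) ℝ :=
  Matrix.of fun i j => σ (θ.Alast.mulVec (θ.hidden σ z).ofLp (i, j) + θ.blast i j)

/-- The initial latent state `σ (U x₀ + v)`. -/
def Params.init (θ : Params d p q) (σ : ℝ → ℝ) (x₀ : EuclideanSpace ℝ (Fin d)) :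
    EuclideanSpace ℝ (Fin p) :=
  layer σ θ.U θ.v x₀

/-! ### The constants of the problem and the parameter set -/

/-- The bounds on the parameters (`BΦ`, `BA`, `Bb`, `BU`, `Bv`), on the initial value of the paths
(`Bx`), the Lipschitz constant of the activation (`Lσ`) and of the paths (`Lx`). -/
structure Bounds where
  BΦ : ℝ≥0
  BA : ℝ≥0
  Bb : ℝ≥0
  BU : ℝ≥0
  Bv : ℝ≥0
  Bx : ℝ≥0
  Lσ : ℝ≥0
  Lx : ℝ≥0

section

attribute [local instance] Matrix.frobeniusNormedAddCommGroup

/-- The parameter set `Θ`; the norms of matrices are Frobenius norms. -/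
def paramSet (d p q : ℕ) (c : Bounds) : Set (Params d p q) :=
  {θ | ‖θ.readout‖ ≤ c.BΦ ∧ (∀ h, ‖θ.A h‖ ≤ c.BA) ∧ (∀ h, ‖θ.b h‖ ≤ c.Bb) ∧
    ‖θ.Alast‖ ≤ c.BA ∧ ‖θ.blast‖ ≤ c.Bb ∧ ‖θ.U‖ ≤ c.BU ∧ ‖θ.v‖ ≤ c.Bv}

end

/-! ### Inputs -/

/-- A sampling grid `0 = t_0 < t_1 < ⋯ < t_K = 1`. -/
structure Grid (K : ℕ) where
  t : Fin (K + 1) → ℝ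
  strictMono : StrictMono t
  zero : t 0 = 0
  one : t (Fin.last K) = 1

/-- The largest gap `|D|` between two consecutive sampling times. -/
def Grid.mesh {K : ℕ} (D : Grid K) : ℝ := ⨆ k : Fin K, (D.t k.succ - D.t k.castSucc)

/-- Continuous inputs: paths that are `Lx`-Lipschitz on `[0,1]` and start in the ball of radius
`Bx`. -/
def PathInput (d : ℕ) (c : Bounds) : Type :=
  {x : ℝ → EuclideanSpace ℝ (Fin d) // LipschitzOnWith c.Lx x (Set.Icc 0 1) ∧ ‖x 0‖ ≤ c.Bx}

/-- Discretized inputs: time series obtained by sampling a continuous input on the grid `D`. -/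
def SeriesInput (d : ℕ) (c : Bounds) {K : ℕ} (D : Grid K) : Type :=
  {y : Fin (K + 1) → EuclideanSpace ℝ (Fin d) //
    ∃ x : PathInput d c, ∀ k, y k = x.1 (D.t k)}

/-! ### Predictors -/

/-- The last latent state `z^D_1 = z^D_{t_K}` of the homogeneous controlled ResNet
`z_{t_{k+1}} = z_{t_k} + G_ψ(z_{t_k}) (x_{t_{k+1}} - x_{t_k})`. -/
def Params.resNetState (θ : Params d p q) (σ : ℝ → ℝ) {K : ℕ}
    (y : Fin (K + 1) → EuclideanSpace ℝ (Fin d)) : EuclideanSpace ℝ (Fin p) :=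
  Fin.foldl K (fun z k => z + mulV (θ.field σ z) (y k.succ - y k.castSucc)) (θ.init σ (y 0))

/-- `I` is the Riemann-Stieltjes integral `∫_a^b f dg`: the tagged Riemann-Stieltjes sums converge
to `I` as the mesh of the partition `a = t_0 ≤ ⋯ ≤ t_N = b` goes to zero. -/
def HasRSIntegral (f : ℝ → Matrix (Fin p) (Fin d) ℝ) (g : ℝ → EuclideanSpace ℝ (Fin d))
    (a b : ℝ) (I : EuclideanSpace ℝ (Fin p)) : Prop :=
  ∀ ε : ℝ, 0 < ε → ∃ δ : ℝ, 0 < δ ∧ ∀ (N : ℕ) (t ξ : ℕ → ℝ), Monotone t → t 0 = a → t N = b →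
    (∀ k < N, ξ k ∈ Set.Icc (t k) (t (k + 1))) → (∀ k < N, t (k + 1) - t k < δ) →
    ‖∑ k ∈ Finset.range N, mulV (f (ξ k)) (g (t (k + 1)) - g (t k)) - I‖ < ε

/-- `z` solves `dz_t = G_ψ(z_t) dx_t` on `[0,1]` with `z_0 = σ (U x_0 + v)`. -/
def Params.IsSolution (θ : Params d p q) (σ : ℝ → ℝ) (x : ℝ → EuclideanSpace ℝ (Fin d))
    (z : ℝ → EuclideanSpace ℝ (Fin p)) : Prop :=
  ContinuousOn z (Set.Icc 0 1) ∧ z 0 = θ.init σ (x 0) ∧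
    ∀ t ∈ Set.Icc (0 : ℝ) 1, HasRSIntegral (fun s => θ.field σ (z s)) x 0 t (z t - z 0)

open Classical in
/-- The latent trajectory: the solution of the controlled differential equation. -/
def Params.trajectory (θ : Params d p q) (σ : ℝ → ℝ) (x : ℝ → EuclideanSpace ℝ (Fin d)) :
    ℝ → EuclideanSpace ℝ (Fin p) :=
  if h : ∃ z, θ.IsSolution σ x z then h.choose else 0

/-- The class `F^D_Θ` of homogeneous controlled ResNets `f_θ(x^D) = Φᵀ z^D_1`, `θ ∈ Θ`. -/
def resNetClass (d p q : ℕ) (σ : ℝ → ℝ) (c : Bounds) {K : ℕ} (D : Grid K) :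
    Set (SeriesInput d c D → ℝ) :=
  (fun θ y => inner ℝ θ.readout (θ.resNetState σ y.1)) '' paramSet d p q c

/-- The class `F_Θ` of NCDE predictors `f_θ(x) = Φᵀ z_1`, `θ ∈ Θ`. -/
def ncdeClass (d p q : ℕ) (σ : ℝ → ℝ) (c : Bounds) : Set (PathInput d c → ℝ) :=
  (fun θ x => inner ℝ θ.readout (θ.trajectory σ x.1 1)) '' paramSet d p q c

/-! ### Covering numbers and Rademacher complexity -/

/-- Covering number `N(F, η)` in the uniform norm: minimal cardinality of a subset `C ⊆ F` such
that every `f ∈ F` is within uniform distance `η` of `C`. -/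
def supCoveringNumber {X : Type*} (F : Set (X → ℝ)) (η : ℝ≥0) : ℕ∞ :=
  Metric.coveringNumber η (UniformFun.ofFun '' F : Set (UniformFun X ℝ))

/-- Empirical Rademacher complexity `E_ε sup_{f ∈ F} (1/n) ∑ ε_i f(x_i)` of `F` on the sample
`x_1, …, x_n`. -/
def empiricalRademacher {X : Type*} (F : Set (X → ℝ)) {n : ℕ} (S : Fin n → X) : ℝ :=
  ((2 : ℝ) ^ n)⁻¹ * ∑ ε : Fin n → Bool,
    ⨆ f : F, (n : ℝ)⁻¹ * ∑ i, (if ε i then 1 else -1) * f.1 (S i)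

/-! ### Explicit constants -/

namespace Bounds

variable (c : Bounds)

/-- `β_h = Lσ Bb ((Lσ BA)^h - 1) / (Lσ BA - 1)`, written as a geometric sum. -/
def β (h : ℕ) : ℝ := c.Lσ * c.Bb * ∑ j ∈ Finset.range h, ((c.Lσ : ℝ) * c.BA) ^ j

/-- `κ_Θ(0) = β_q`. -/
def κ (q : ℕ) : ℝ := c.β q

/-- Lipschitz constant `(Lσ BA)^q` of the vector fields. -/
def lipField (q : ℕ) : ℝ := ((c.Lσ : ℝ) * c.BA) ^ q

/-- Bound on the latent trajectories for continuous inputs. -/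
def radius (q : ℕ) : ℝ :=
  (c.Lσ * (c.BU * c.Bx + c.Bv) + c.κ q * c.Lx) * Real.exp (c.lipField q * c.Lx)

/-- Bound on the latent trajectories for inputs sampled on `D`. -/
def radiusD (q : ℕ) {K : ℕ} (D : Grid K) : ℝ :=
  (c.Lσ * (c.BU * c.Bx + c.Bv) + c.κ q * c.Lx) * (1 + c.lipField q * c.Lx * D.mesh) ^ K

/-- `M_Θ` -/
def M (q : ℕ) : ℝ := c.BΦ * c.radius q

/-- `M^D_Θ` -/
def MD (q : ℕ) {K : ℕ} (D : Grid K) : ℝ := c.BΦ * c.radiusD q D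

/-- `C_A`, when the latent trajectories live in the ball `Ω` of radius `R`:
`BΦ Lx exp((Lσ BA)^q Lx) max_{z ∈ Ω, 1 ≤ i ≤ q} (Lσ BA)^(q-i) Lσ ((Lσ BA)^(i-1) ‖z‖ + β_{i-1})`. -/
def CA (q : ℕ) (R : ℝ) : ℝ :=
  c.BΦ * c.Lx * Real.exp (c.lipField q * c.Lx) *
    ⨆ i : Fin q, ((c.Lσ : ℝ) * c.BA) ^ (q - 1 - (i : ℕ)) * c.Lσ *
      (((c.Lσ : ℝ) * c.BA) ^ (i : ℕ) * R + c.β i)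

/-- `C_b = BΦ Lx exp((Lσ BA)^q Lx) max_{1 ≤ i ≤ q} (Lσ BA)^(q-i) Lσ`. -/
def Cb (q : ℕ) : ℝ :=
  c.BΦ * c.Lx * Real.exp (c.lipField q * c.Lx) *
    ⨆ i : Fin q, ((c.Lσ : ℝ) * c.BA) ^ (q - 1 - (i : ℕ)) * c.Lσ

/-- `C_U` -/
def CU (q : ℕ) : ℝ := c.BΦ * c.Bx * Real.exp (c.lipField q * c.Lx) * c.Lσ

/-- `C_v` -/
def Cv (q : ℕ) : ℝ := c.BΦ * Real.exp (c.lipField q * c.Lx) * c.Lσ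

/-- `K_1` as a function of the radius `R` of the ball containing the latent trajectories. -/
def K₁ (q : ℕ) (R : ℝ) : ℝ := max (c.BΦ * R) (c.Bv * c.Cv q)

/-- `K_2` as a function of the radius `R` of the ball containing the latent trajectories. -/
def K₂ (q : ℕ) (R : ℝ) : ℝ := max (max (c.Bb * c.Cb q) (c.BA * c.CA q R)) (c.BU * c.CU q)

end Bounds

/-- `C_q = 8 q + 12`. -/
def Cq (q : ℕ) : ℝ := 8 * q + 12

/-- The product
`(1 + C_q K₁ √p / 2η)^((q+1)p(1+p)) (1 + C_q K₂ (√p + √d) / 2η)^(2dp) (1 + C_q K₁ √(dp) / 2η)^(dp²)`. -/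
def coveringBound (d p q : ℕ) (K₁ K₂ η : ℝ) : ℝ :=
  (1 + Cq q * K₁ / (2 * η) * √p) ^ ((q + 1) * p * (1 + p)) *
    (1 + Cq q * K₂ / (2 * η) * (√p + √d)) ^ (2 * d * p) *
    (1 + Cq q * K₁ / (2 * η) * √(d * p)) ^ (d * p ^ 2)

/-- The product
`(1 + C_q K₁ / 2η)^(2p) (1 + C_q K₂ √p / 2η)^((q-1)p(1+p)) (1 + C_q K₂ √(dp) / 2η)^(dp(2+p))`. -/
def coveringBound' (d p q : ℕ) (K₁ K₂ η : ℝ) : ℝ :=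
  (1 + Cq q * K₁ / (2 * η)) ^ (2 * p) *
    (1 + Cq q * K₂ / (2 * η) * √p) ^ ((q - 1) * p * (1 + p)) *
    (1 + Cq q * K₂ / (2 * η) * √(d * p)) ^ (d * p * (2 + p))

/-- `U_1 = log (√n C_q K₁)`. -/
def U₁ (q n : ℕ) (K₁ : ℝ) : ℝ := Real.log (√n * Cq q * K₁)

/-- `U_2 = log (√(np) C_q K₂)`. -/
def U₂ (p q n : ℕ) (K₂ : ℝ) : ℝ := Real.log (√(n * p) * Cq q * K₂)

/-- `U_3 = log (√(ndp) C_q K₂)`. -/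
def U₃ (d p q n : ℕ) (K₂ : ℝ) : ℝ := Real.log (√(n * d * p) * Cq q * K₂)

/-- `4/n + 24 M/√n · √((q+1)p(p+1) U_1 + 2dp U_2 + dp² U_3)`. -/
def rademacherBound (d p q n : ℕ) (M K₁ K₂ : ℝ) : ℝ :=
  4 / n + 24 * M / √n *
    √((q + 1) * p * (p + 1) * U₁ q n K₁ + 2 * d * p * U₂ p q n K₂ + d * p ^ 2 * U₃ d p q n K₂)

/-- `4/n + 24 M/√n · √(2p U_1 + (q-1)p(p+1) U_2 + dp(2+p) U_3)`. -/
def rademacherBound' (d p q n : ℕ) (M K₁ K₂ : ℝ) : ℝ :=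
  4 / n + 24 * M / √n *
    √(2 * p * U₁ q n K₁ + ((q : ℝ) - 1) * p * (p + 1) * U₂ p q n K₂ +
      d * p * (2 + p) * U₃ d p q n K₂)

end

end NCDE

/-! Everything follows from one fact: a predictor is Lipschitz in its parameters, uniformly over the
inputs, with an explicit constant for each block of parameters.

The vector field grows at most affinely, is `lipField`-Lipschitz in the state, and moves by at most
`fieldGap` when the parameters change (`norm_field_le`, `norm_field_sub_le`). A ResNet on a sampled
path is an Euler scheme, so `discrete_gronwall` turns these facts into a bound on the states and a
stability estimate. For continuous inputs the dyadic Euler schemes form a Cauchy sequence whose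
limit solves the equation. Instead of manipulating integrals, the argument uses the local expansion
`IsDriven`, which is equivalent to being a solution and gives uniqueness by Grönwall. The Euler
estimates have constants uniform in the step, so they pass to the limit. Both classes thus satisfy
`IsStable`, and the rest of the argument is common to them.

Covering: there are `2q + 3` blocks of parameters (the readout, `U`, `v`, and `q` weights and `q`
biases). Each is netted in its own ball so that it contributes error at most `η / (2q + 3)`. A
volume argument in Frobenius norm bounds each net with the dimension of the block as exponent, and
`Cq q = 4 (2q + 3)` gives the base. The net points lie in `Θ`, so the cover is internal. The
resulting product (`IsStable.exists_cover`) has no square roots of dimensions and is below both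
stated bounds.

Rademacher complexity: at scale `M / 2 ^ j` the logarithm of that product is at most `W (j + 1)`,
where `W` is a combination of logarithms. Chaining over dyadic scales with such linear entropy gives
`(21/2) M √W / √n`. This is stronger than both stated bounds: the constant 24, the larger logarithms
and the term `4 / n` are slack. -/

open scoped NNReal ENNReal

namespace NCDE

/-! ### Volume bounds for nets of balls in finite dimension -/

section Packing

open MeasureTheory Module Metric

variable {E : Type*} [NormedAddCommGroup E] [NormedSpace ℝ E] [FiniteDimensional ℝ E]

/-- The balls of radius `r / 2` around the points are disjoint and lie in the ball of radius `B + r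
/ 2`. Comparing Haar measures gives the ratio of radii to the power of the dimension. -/
theorem card_le_of_separated_of_norm_le {B r : ℝ} (hB : 0 ≤ B) (hr : 0 < r) (C : Finset E)
    (hC : ∀ x ∈ C, ‖x‖ ≤ B) (hs : ∀ x ∈ C, ∀ y ∈ C, x ≠ y → r < ‖x - y‖) :
    (C.card : ℝ) ≤ (1 + 2 * B / r) ^ finrank ℝ E := by
  borelize E
  let μ : Measure E := Measure.addHaar
  have hr2 : 0 < r / 2 := by positivity
  have D : Set.Pairwise (C : Set E) (Function.onFun Disjoint fun c => ball c (r / 2)) := by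
    rintro c hc d hd hcd
    apply ball_disjoint_ball
    rw [dist_eq_norm]
    linarith [hs c hc d hd hcd]
  have hsub : (⋃ c ∈ C, ball c (r / 2)) ⊆ ball (0 : E) (B + r / 2) := by
    refine Set.iUnion₂_subset fun x hx => ?_
    apply ball_subset_ball'
    rw [dist_zero_right]
    linarith [hC x hx]
  have I : (C.card : ℝ≥0∞) * ENNReal.ofReal ((r / 2) ^ finrank ℝ E) * μ (ball 0 1) ≤
      ENNReal.ofReal ((B + r / 2) ^ finrank ℝ E) * μ (ball 0 1) :=
    calc
      _ = μ (⋃ c ∈ C, ball c (r / 2)) := by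
        rw [measure_biUnion_finset D fun c _ => measurableSet_ball]
        simp only [μ.addHaar_ball_of_pos _ hr2, Finset.sum_const, nsmul_eq_mul, mul_assoc]
      _ ≤ μ (ball (0 : E) (B + r / 2)) := measure_mono hsub
      _ = _ := μ.addHaar_ball_of_pos _ (by positivity)
  have J : (C.card : ℝ≥0∞) * ENNReal.ofReal ((r / 2) ^ finrank ℝ E) ≤
      ENNReal.ofReal ((B + r / 2) ^ finrank ℝ E) :=
    (ENNReal.mul_le_mul_iff_left (measure_ball_pos _ _ zero_lt_one).ne' measure_ball_lt_top.ne).1 I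
  have K : (C.card : ℝ) * (r / 2) ^ finrank ℝ E ≤ (B + r / 2) ^ finrank ℝ E := by
    rw [← ENNReal.ofReal_natCast, ← ENNReal.ofReal_mul (by positivity)] at J
    exact (ENNReal.ofReal_le_ofReal_iff (by positivity)).1 J
  rw [← le_div_iff₀ (by positivity), ← div_pow] at K
  have e : (B + r / 2) / (r / 2) = 1 + 2 * B / r := by field_simp; ring
  rwa [e] at K

/-- A ball of radius `B` has an internal `r`-net of cardinality at most `(1 + 2 B / r) ^ dim E`. -/
theorem exists_net_closedBall {B r : ℝ} (hB : 0 ≤ B) (hr : 0 < r) :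
    ∃ C : Finset E, (∀ x ∈ C, ‖x‖ ≤ B) ∧ (∀ x, ‖x‖ ≤ B → ∃ y ∈ C, ‖x - y‖ ≤ r) ∧
      (C.card : ℝ) ≤ (1 + 2 * B / r) ^ finrank ℝ E := by
  classical
  -- A separated set of maximal cardinality is a net, since an uncovered point could be added to it.
  -- The maximum exists because the volume bound caps the cardinalities.
  let P : ℕ → Prop := fun k => ∃ C : Finset E, C.card = k ∧ (∀ x ∈ C, ‖x‖ ≤ B) ∧
    ∀ x ∈ C, ∀ y ∈ C, x ≠ y → r < ‖x - y‖
  have hP : ∀ k, P k → k ≤ ⌊(1 + 2 * B / r) ^ finrank ℝ E⌋₊ := by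
    rintro k ⟨C, rfl, h1, h2⟩
    exact Nat.le_floor (card_le_of_separated_of_norm_le hB hr C h1 h2)
  obtain ⟨C, hcard, h1, h2⟩ : P (Nat.findGreatest P ⌊(1 + 2 * B / r) ^ finrank ℝ E⌋₊) :=
    Nat.findGreatest_spec (Nat.zero_le _) ⟨∅, by simp⟩
  refine ⟨C, h1, fun x hx => ?_, card_le_of_separated_of_norm_le hB hr C h1 h2⟩
  by_contra! hcon
  have hxC : x ∉ C := fun h => by
    have := hcon x h
    simp only [sub_self, norm_zero] at this
    linarith
  have hk : P (C.card + 1) := by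
    refine ⟨insert x C, Finset.card_insert_of_notMem hxC, ?_, ?_⟩
    · simpa using ⟨hx, h1⟩
    · intro y hy z hz hyz
      rcases Finset.mem_insert.1 hy with rfl | hy'
      · rcases Finset.mem_insert.1 hz with rfl | hz
        · exact absurd rfl hyz
        · exact hcon z hz
      · rcases Finset.mem_insert.1 hz with rfl | hz
        · rw [norm_sub_rev]
          exact hcon y hy'
        · exact h2 y hy' z hz hyz
  have := Nat.le_findGreatest (hP _ hk) hk
  omega

/-- The same for the seminorm `a ‖·‖`, where `a` may vanish. -/
theorem exists_net_closedBall_mul {B a δ : ℝ} (hB : 0 ≤ B) (ha : 0 ≤ a) (hδ : 0 < δ) :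
    ∃ C : Finset E, (∀ x ∈ C, ‖x‖ ≤ B) ∧ (∀ x, ‖x‖ ≤ B → ∃ y ∈ C, a * ‖x - y‖ ≤ δ) ∧
      (C.card : ℝ) ≤ (1 + 2 * (B * a) / δ) ^ finrank ℝ E := by
  rcases ha.eq_or_lt with rfl | ha
  · exact ⟨{0}, by simpa using hB, fun x _ => ⟨0, by simp, by simpa using hδ.le⟩, by simp⟩
  · obtain ⟨C, h1, h2, h3⟩ := exists_net_closedBall (E := E) hB (div_pos hδ ha)
    refine ⟨C, h1, fun x hx => ?_, h3.trans (le_of_eq ?_)⟩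
    · obtain ⟨y, hy, h⟩ := h2 x hx
      refine ⟨y, hy, ?_⟩
      rwa [le_div_iff₀ ha, mul_comm] at h
    · congr 2
      field_simp

end Packing

/-! ### Rademacher sums over finite classes -/

section Rademacher

/-- The Rademacher sum `∑ ε_i v_i`. -/
def signSum {n : ℕ} (ε : Fin n → Bool) (v : Fin n → ℝ) : ℝ :=
  ∑ i, (if ε i then 1 else -1) * v i

theorem signSum_sub {n : ℕ} (ε : Fin n → Bool) (v w : Fin n → ℝ) :
    signSum ε (v - w) = signSum ε v - signSum ε w := by
  simp [signSum, mul_sub, Finset.sum_sub_distrib]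

theorem abs_signSum_le {n : ℕ} (ε : Fin n → Bool) {v : Fin n → ℝ} {r : ℝ} (h : ∀ i, |v i| ≤ r) :
    |signSum ε v| ≤ n * r := by
  refine (Finset.abs_sum_le_sum_abs _ _).trans ?_
  calc _ ≤ ∑ _i : Fin n, r := by
        refine Finset.sum_le_sum fun i _ => ?_
        rw [abs_mul]
        refine (le_of_eq ?_).trans (h i)
        split_ifs <;> simp
    _ = n * r := by simp

/-- The sum over signs factors over coordinates into terms `2 cosh (l * v i)`, and `cosh x ≤ exp (x²
/ 2)`. -/
theorem sum_exp_signSum_le {n : ℕ} {v : Fin n → ℝ} {r : ℝ} (h : ∀ i, |v i| ≤ r) (l : ℝ) :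
    ∑ ε : Fin n → Bool, Real.exp (l * signSum ε v) ≤
      2 ^ n * Real.exp (n * (l ^ 2 * r ^ 2 / 2)) := by
  have h1 : ∀ ε : Fin n → Bool, Real.exp (l * signSum ε v) =
      ∏ i, Real.exp (l * ((if ε i then 1 else -1) * v i)) := fun ε => by
    rw [← Real.exp_sum, signSum, Finset.mul_sum]
  simp_rw [h1]
  rw [← Fintype.prod_sum fun (i : Fin n) (b : Bool) =>
    Real.exp (l * ((if b then 1 else -1) * v i))]
  calc _ ≤ ∏ _i : Fin n, (2 * Real.exp (l ^ 2 * r ^ 2 / 2)) := by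
        refine Finset.prod_le_prod (fun i _ => by positivity) fun i _ => ?_
        have h2 := Real.cosh_le_exp_half_sq (l * v i)
        rw [Real.cosh_eq] at h2
        have h3 : (l * v i) ^ 2 / 2 ≤ l ^ 2 * r ^ 2 / 2 := by
          rw [mul_pow]
          have : v i ^ 2 ≤ r ^ 2 := sq_le_sq' (by linarith [neg_abs_le (v i), h i])
            ((le_abs_self _).trans (h i))
          gcongr
        have h4 := Real.exp_le_exp.2 h3
        simp only [Fintype.sum_bool, if_true, Bool.false_eq_true, if_false, one_mul, neg_mul,
          mul_neg]
        linarith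
    _ = _ := by
      rw [Finset.prod_const, Finset.card_univ, Fintype.card_fin, mul_pow, ← Real.exp_nat_mul]

/-- **Massart's finite class lemma**, for arbitrary selections from a finite set. -/
theorem sum_signSum_le_of_finset {n : ℕ} (P : Finset (Fin n → ℝ)) {r L l : ℝ} (hl : 0 < l)
    (hP : ∀ v ∈ P, ∀ i, |v i| ≤ r) (hcard : (P.card : ℝ) ≤ Real.exp L)
    (u : (Fin n → Bool) → Fin n → ℝ) (hu : ∀ ε, u ε ∈ P) :
    ∑ ε, signSum ε (u ε) ≤ 2 ^ n * (L / l + l * n * r ^ 2 / 2) := by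
  set c := L + n * (l ^ 2 * r ^ 2 / 2) with hc
  have h1 : ∑ ε, Real.exp (l * signSum ε (u ε)) ≤ 2 ^ n * Real.exp c := by
    calc _ ≤ ∑ ε : Fin n → Bool, ∑ v ∈ P, Real.exp (l * signSum ε v) :=
          Finset.sum_le_sum fun ε _ => Finset.single_le_sum
            (f := fun v => Real.exp (l * signSum ε v)) (fun v _ => (Real.exp_pos _).le) (hu ε)
      _ = ∑ v ∈ P, ∑ ε : Fin n → Bool, Real.exp (l * signSum ε v) := Finset.sum_comm
      _ ≤ ∑ _v ∈ P, 2 ^ n * Real.exp (n * (l ^ 2 * r ^ 2 / 2)) :=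
          Finset.sum_le_sum fun v hv => sum_exp_signSum_le (hP v hv) l
      _ = P.card * (2 ^ n * Real.exp (n * (l ^ 2 * r ^ 2 / 2))) := by simp
      _ ≤ Real.exp L * (2 ^ n * Real.exp (n * (l ^ 2 * r ^ 2 / 2))) := by gcongr
      _ = _ := by rw [hc, Real.exp_add]; ring
  -- The tangent line of the exponential at `c` plays the role of Jensen's inequality: summed over
  -- `ε`, it bounds the mean of the exponents by the logarithm `c` of the bound on the mean of the
  -- exponentials.
  have h2 : ∀ ε, l * signSum ε (u ε) ≤
      c - 1 + Real.exp (-c) * Real.exp (l * signSum ε (u ε)) := fun ε => by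
    have := Real.add_one_le_exp (-c + l * signSum ε (u ε))
    rw [Real.exp_add] at this
    linarith
  have h3 : l * ∑ ε, signSum ε (u ε) ≤ 2 ^ n * c := by
    rw [Finset.mul_sum]
    calc _ ≤ ∑ ε, (c - 1 + Real.exp (-c) * Real.exp (l * signSum ε (u ε))) :=
          Finset.sum_le_sum fun ε _ => h2 ε
      _ = 2 ^ n * (c - 1) + Real.exp (-c) * ∑ ε, Real.exp (l * signSum ε (u ε)) := by
          rw [Finset.sum_add_distrib, Finset.mul_sum]; simp [mul_sub]
      _ ≤ 2 ^ n * (c - 1) + Real.exp (-c) * (2 ^ n * Real.exp c) := by gcongr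
      _ = 2 ^ n * c := by
          have : Real.exp (-c) * Real.exp c = 1 := by rw [← Real.exp_add]; simp
          linear_combination 2 ^ n * this
  have h4 : ∑ ε, signSum ε (u ε) ≤ 2 ^ n * c / l := by
    rw [le_div_iff₀ hl]; linarith
  refine h4.trans (le_of_eq ?_)
  rw [hc]
  field_simp

end Rademacher

/-! ### Dyadic chaining -/

section Rademacher

/-- **Chaining** along nets at the scales `M / 2 ^ j`, for arbitrary selections. -/
theorem sum_signSum_le_chaining {n : ℕ} (hn : 0 < n) (T : Set (Fin n → ℝ)) {M τ : ℝ} (hM : 0 < M)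
    (hτ : 0 < τ) {H : ℕ → ℝ} (hH : Monotone H) (hH0 : 0 ≤ H 0) (hT : ∀ t ∈ T, ∀ i, |t i| ≤ M)
    (hnet : ∀ j, ∃ P : Finset (Fin n → ℝ), (P.card : ℝ) ≤ Real.exp (H j) ∧
      ∀ t ∈ T, ∃ v ∈ P, ∀ i, |t i - v i| ≤ M / 2 ^ j) (J : ℕ)
    (u : (Fin n → Bool) → Fin n → ℝ) (hu : ∀ ε, u ε ∈ T) :
    ∑ ε, signSum ε (u ε) ≤ 2 ^ n * (∑ j ∈ Finset.range J,
      3 * M / 2 ^ (j + 1) * √n * (2 * H (j + 1) / τ + τ / 2) + n * (M / 2 ^ J)) := by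
  classical
  -- The coarsest net may be taken to be `{0}`, because `T` lies in the sup-ball of radius `M`. The
  -- chain then starts at zero and level 0 contributes nothing.
  have hnet' : ∀ j, ∃ P : Finset (Fin n → ℝ), (P.card : ℝ) ≤ Real.exp (H j) ∧
      (∀ t ∈ T, ∃ v ∈ P, ∀ i, |t i - v i| ≤ M / 2 ^ j) ∧ (j = 0 → P = {0}) := by
    intro j
    rcases Nat.eq_zero_or_pos j with rfl | hj
    · exact ⟨{0}, by simpa using hH0, fun t ht => ⟨0, by simp, by simpa using hT t ht⟩, by simp⟩
    · obtain ⟨P, h1, h2⟩ := hnet j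
      exact ⟨P, h1, h2, fun h => absurd h hj.ne'⟩
  choose P hcard hP hP0 using hnet'
  have hπ : ∀ j ε, ∃ v ∈ P j, ∀ i, |u ε i - v i| ≤ M / 2 ^ j := fun j ε => hP j _ (hu ε)
  choose π hπP hπ using hπ
  have main : ∀ J, ∑ ε, signSum ε (π J ε) ≤ 2 ^ n * ∑ j ∈ Finset.range J,
      3 * M / 2 ^ (j + 1) * √n * (2 * H (j + 1) / τ + τ / 2) := by
    intro J
    induction J with
    | zero =>
      have : ∀ ε, π 0 ε = 0 := fun ε => by simpa [hP0 0 rfl] using hπP 0 ε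
      simp [this, signSum]
    | succ J ih =>
      set r := 3 * M / 2 ^ (J + 1) with hr
      have hr0 : 0 < r := by positivity
      have hn0 : 0 < √(n : ℝ) := by positivity
      have hsq : √(n : ℝ) ^ 2 = n := Real.sq_sqrt (by positivity)
      -- Massart's lemma needs the bound `r` on every member, so only the short differences are
      -- kept. The links of the chain are among them by the triangle inequality, `M / 2 ^ J + M / 2
      -- ^ (J + 1) = r`.
      set Q := (Finset.image₂ (fun v w : Fin n → ℝ => v - w) (P (J + 1)) (P J)).filter
        fun v => ∀ i, |v i| ≤ r with hQ
      have hQcard : (Q.card : ℝ) ≤ Real.exp (2 * H (J + 1)) := by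
        have h1 : Q.card ≤ (P (J + 1)).card * (P J).card :=
          (Finset.card_filter_le _ _).trans (Finset.card_image₂_le _ _ _)
        calc (Q.card : ℝ) ≤ (P (J + 1)).card * (P J).card := by exact_mod_cast h1
          _ ≤ Real.exp (H (J + 1)) * Real.exp (H J) := by
            gcongr
            · exact hcard _
            · exact hcard _
          _ ≤ Real.exp (H (J + 1)) * Real.exp (H (J + 1)) := by
            gcongr
            exact hH (Nat.le_succ J)
          _ = _ := by rw [← Real.exp_add]; ring_nf
      have hmem : ∀ ε, π (J + 1) ε - π J ε ∈ Q := by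
        intro ε
        rw [hQ, Finset.mem_filter]
        refine ⟨Finset.mem_image₂.2 ⟨_, hπP _ ε, _, hπP _ ε, rfl⟩, fun i => ?_⟩
        have h1 := hπ (J + 1) ε i
        have h2 := hπ J ε i
        have h3 : M / 2 ^ J + M / 2 ^ (J + 1) = r := by rw [hr, pow_succ]; field_simp; ring
        rw [abs_le] at h1 h2 ⊢
        simp only [Pi.sub_apply]
        constructor <;> linarith
      -- With this choice every level contributes `r √n (2 H / τ + τ / 2)`, with the same free
      -- parameter `τ`.
      have hl : 0 < τ / (r * √n) := by positivity
      have := sum_signSum_le_of_finset Q hl (fun v hv => (Finset.mem_filter.1 hv).2) hQcard _ hmem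
      have e : 2 * H (J + 1) / (τ / (r * √n)) + τ / (r * √n) * n * r ^ 2 / 2 =
          r * √n * (2 * H (J + 1) / τ + τ / 2) := by
        clear_value r
        generalize √(n : ℝ) = x at hsq hn0
        rw [← hsq]
        field_simp
      rw [e] at this
      rw [Finset.sum_range_succ, mul_add]
      simp only [signSum_sub, Finset.sum_sub_distrib] at this
      linarith
  have hlast : ∀ ε, signSum ε (u ε) ≤ signSum ε (π J ε) + n * (M / 2 ^ J) := by
    intro ε
    have h1 := abs_signSum_le ε (v := u ε - π J ε) (hπ J ε)
    rw [signSum_sub] at h1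
    linarith [(abs_le.1 h1).2]
  calc _ ≤ ∑ ε, (signSum ε (π J ε) + n * (M / 2 ^ J)) := Finset.sum_le_sum fun ε _ => hlast ε
    _ = ∑ ε, signSum ε (π J ε) + 2 ^ n * (n * (M / 2 ^ J)) := by
      rw [Finset.sum_add_distrib]; simp
    _ ≤ _ := by
      rw [mul_add]
      gcongr
      exact main J

/-- Chaining with `τ = 3 √W`. Since `∑ (j + 2) / 2 ^ (j + 1) = 3` and `∑ 1 / 2 ^ (j + 1) = 1`, the
levels add up to `3 M √n √W (2 + 3 / 2)`, whence the constant `21 / 2`. The discretization error `n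
M / 2 ^ J` vanishes in the limit. -/
theorem sum_signSum_le_of_linear_entropy {n : ℕ} (hn : 0 < n) (T : Set (Fin n → ℝ)) {M W : ℝ}
    (hM : 0 < M) (hW : 0 < W) (hT : ∀ t ∈ T, ∀ i, |t i| ≤ M)
    (hnet : ∀ j : ℕ, ∃ P : Finset (Fin n → ℝ), (P.card : ℝ) ≤ Real.exp (W * (j + 1)) ∧
      ∀ t ∈ T, ∃ v ∈ P, ∀ i, |t i - v i| ≤ M / 2 ^ j)
    (u : (Fin n → Bool) → Fin n → ℝ) (hu : ∀ ε, u ε ∈ T) :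
    ∑ ε, signSum ε (u ε) ≤ 2 ^ n * (21 / 2 * M * √n * √W) := by
  have hs : 0 < √W := by positivity
  have hs2 : √W ^ 2 = W := Real.sq_sqrt hW.le
  have hmono : Monotone fun j : ℕ => W * ((j : ℝ) + 1) := fun a b hab => by
    have : (a : ℝ) ≤ b := by exact_mod_cast hab
    simp only
    gcongr
  have hsum : ∀ J, ∑ j ∈ Finset.range J,
      3 * M / 2 ^ (j + 1) * √n * (2 * (W * (((j + 1 : ℕ) : ℝ) + 1)) / (3 * √W) + 3 * √W / 2) =
      3 * M * √n * √W * (2 / 3 * (3 - (J + 3) / 2 ^ J) + 3 / 2 * (1 - 1 / 2 ^ J)) := by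
    intro J
    induction J with
    | zero => simp
    | succ J ih =>
      rw [Finset.sum_range_succ, ih]
      push_cast
      have : 2 * (W * ((J : ℝ) + 1 + 1)) / (3 * √W) = 2 / 3 * √W * (J + 2) := by
        nth_rewrite 1 [← hs2]
        field_simp
        ring
      rw [this, pow_succ]
      field_simp
      ring
  have hJ : ∀ J : ℕ, ∑ ε, signSum ε (u ε) ≤
      2 ^ n * (21 / 2 * M * √n * √W + n * (M / 2 ^ J)) := by
    intro J
    refine (sum_signSum_le_chaining hn T hM (by positivity : 0 < 3 * √W) hmono
      (by simpa using hW.le) hT hnet J u hu).trans ?_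
    rw [hsum]
    refine mul_le_mul_of_nonneg_left (add_le_add ?_ le_rfl) (by positivity)
    have h1 : 0 ≤ ((J : ℝ) + 3) / 2 ^ J := by positivity
    have h2 : 0 ≤ (1 : ℝ) / 2 ^ J := by positivity
    have h3 : 0 ≤ 3 * M * √n * √W := by positivity
    nlinarith
  have hlim : Filter.Tendsto (fun J : ℕ => 2 ^ n * (21 / 2 * M * √n * √W + n * (M / 2 ^ J)))
      Filter.atTop (nhds (2 ^ n * (21 / 2 * M * √n * √W + n * 0))) := by
    refine ((Filter.Tendsto.const_mul _ ?_).const_add _).const_mul _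
    simp_rw [div_eq_mul_inv, ← inv_pow]
    rw [← mul_zero M]
    exact (tendsto_pow_atTop_nhds_zero_of_lt_one (by norm_num) (by norm_num)).const_mul _
  have := ge_of_tendsto' hlim hJ
  simpa using this

/-- Chaining bound on the empirical Rademacher complexity of a class whose metric entropy at the
scale `M / 2 ^ j` grows at most linearly in `j`. -/
theorem empiricalRademacher_le_of_linear_entropy {X : Type*} {F : Set (X → ℝ)} (hF : F.Nonempty)
    {n : ℕ} (hn : 0 < n) (S : Fin n → X) {M W : ℝ} (hM : 0 < M) (hW : 0 < W)
    (hFM : ∀ f ∈ F, ∀ x, |f x| ≤ M)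
    (hnet : ∀ j : ℕ, ∃ P : Finset (X → ℝ), (P.card : ℝ) ≤ Real.exp (W * (j + 1)) ∧
      ∀ f ∈ F, ∃ g ∈ P, ∀ x, |f x - g x| ≤ M / 2 ^ j) :
    empiricalRademacher F S ≤ 21 / 2 * M / √n * √W := by
  classical
  have : Nonempty F := hF.to_subtype
  have hn0 : (0 : ℝ) < n := by exact_mod_cast hn
  have hn1 : 0 < √(n : ℝ) := by positivity
  have hsq : √(n : ℝ) ^ 2 = n := Real.sq_sqrt (by positivity)
  refine le_of_forall_pos_le_add fun δ hδ => ?_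
  -- The supremum need not be attained. A `δ`-maximizer is selected for each sign pattern, which is
  -- why the chaining bounds are stated for arbitrary selections.
  have hsel : ∀ ε : Fin n → Bool, ∃ f : F,
      (⨆ f : F, (n : ℝ)⁻¹ * ∑ i, (if ε i then 1 else -1) * f.1 (S i)) - δ <
        (n : ℝ)⁻¹ * ∑ i, (if ε i then 1 else -1) * f.1 (S i) := fun ε =>
    exists_lt_of_lt_ciSup (sub_lt_self _ hδ)
  choose f hf using hsel
  have key := sum_signSum_le_of_linear_entropy hn ((fun f : X → ℝ => fun i => f (S i)) '' F) hM hW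
    (by rintro _ ⟨f, hf, rfl⟩ i; exact hFM f hf _)
    (by
      intro j
      obtain ⟨P, h1, h2⟩ := hnet j
      refine ⟨P.image fun f i => f (S i),
        le_trans (by exact_mod_cast Finset.card_image_le) h1, ?_⟩
      rintro _ ⟨f, hf, rfl⟩
      obtain ⟨g, hg, h⟩ := h2 f hf
      exact ⟨_, Finset.mem_image_of_mem _ hg, fun i => h _⟩)
    (fun ε i => (f ε).1 (S i)) (fun ε => ⟨(f ε).1, (f ε).2, rfl⟩)
  have hsum : ∑ ε : Fin n → Bool, (⨆ f : F, (n : ℝ)⁻¹ * ∑ i, (if ε i then 1 else -1) * f.1 (S i)) ≤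
      2 ^ n * ((n : ℝ)⁻¹ * (21 / 2 * M * √n * √W) + δ) := by
    calc _ ≤ ∑ ε : Fin n → Bool, ((n : ℝ)⁻¹ * signSum ε (fun i => (f ε).1 (S i)) + δ) :=
          Finset.sum_le_sum fun ε _ => by
            have := hf ε
            rw [signSum]
            linarith
      _ = (n : ℝ)⁻¹ * ∑ ε, signSum ε (fun i => (f ε).1 (S i)) + 2 ^ n * δ := by
          rw [Finset.sum_add_distrib, ← Finset.mul_sum]; simp
      _ ≤ (n : ℝ)⁻¹ * (2 ^ n * (21 / 2 * M * √n * √W)) + 2 ^ n * δ := by gcongr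
      _ = _ := by ring
  calc empiricalRademacher F S ≤
        ((2 : ℝ) ^ n)⁻¹ * (2 ^ n * ((n : ℝ)⁻¹ * (21 / 2 * M * √n * √W) + δ)) := by
        unfold empiricalRademacher
        gcongr
    _ = (n : ℝ)⁻¹ * (21 / 2 * M * √n * √W) + δ := by field_simp
    _ = _ := by
        generalize √(n : ℝ) = x at hsq hn1
        rw [← hsq]
        field_simp

end Rademacher

/-! ### Layers and neural vector fields in Frobenius norm -/

section Network

attribute [local instance] Matrix.frobeniusNormedAddCommGroup Matrix.frobeniusNormedSpace

/-! ### Norm estimates for affine layers -/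

section Affine

variable {m n : Type*} [Fintype m] [Fintype n]

theorem frobenius_norm_eq_sqrt (A : Matrix m n ℝ) : ‖A‖ = √(∑ i, ∑ j, A i j ^ 2) := by
  rw [Matrix.frobenius_norm_def, Real.sqrt_eq_rpow]
  simp

/-- Entries of a matrix, as a Euclidean vector. -/
def vec (A : Matrix m n ℝ) : EuclideanSpace ℝ (m × n) := WithLp.toLp 2 fun ij => A ij.1 ij.2

theorem norm_vec (A : Matrix m n ℝ) : ‖vec A‖ = ‖A‖ := by
  rw [frobenius_norm_eq_sqrt, EuclideanSpace.norm_eq, Fintype.sum_prod_type]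
  simp [vec]

theorem vec_sub {m n : Type*} (A B : Matrix m n ℝ) : vec (A - B) = vec A - vec B := rfl

theorem norm_toLp_mulVec_le (A : Matrix m n ℝ) (x : EuclideanSpace ℝ n) :
    ‖WithLp.toLp 2 (A.mulVec x.ofLp)‖ ≤ ‖A‖ * ‖x‖ := by
  have h : 0 ≤ ∑ i, ∑ j, A i j ^ 2 :=
    Finset.sum_nonneg fun i _ => Finset.sum_nonneg fun j _ => sq_nonneg _
  rw [frobenius_norm_eq_sqrt, EuclideanSpace.norm_eq, EuclideanSpace.norm_eq, ← Real.sqrt_mul h]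
  apply Real.sqrt_le_sqrt
  rw [Finset.sum_mul]
  refine Finset.sum_le_sum fun i _ => ?_
  simp only [Real.norm_eq_abs, sq_abs]
  exact Finset.sum_mul_sq_le_sq_mul_sq _ _ _

theorem norm_le_mul_norm_of_entries {L : ℝ} (hL : 0 ≤ L) {v w : EuclideanSpace ℝ m}
    (h : ∀ i, |v i| ≤ L * |w i|) : ‖v‖ ≤ L * ‖w‖ := by
  rw [EuclideanSpace.norm_eq, EuclideanSpace.norm_eq, ← Real.sqrt_sq hL,
    ← Real.sqrt_mul (sq_nonneg L)]
  apply Real.sqrt_le_sqrt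
  rw [Finset.mul_sum]
  refine Finset.sum_le_sum fun i _ => ?_
  rw [← mul_pow]
  exact pow_le_pow_left₀ (norm_nonneg _) (h i) 2

/-- A fully connected layer with arbitrary index types. -/
def affineLayer (σ : ℝ → ℝ) (A : Matrix m n ℝ) (b : EuclideanSpace ℝ m) (z : EuclideanSpace ℝ n) :
    EuclideanSpace ℝ m :=
  WithLp.toLp 2 fun i => σ (A.mulVec z.ofLp i + b i)

variable {L : ℝ≥0} {σ : ℝ → ℝ}

theorem norm_affineLayer_le (hσ : LipschitzWith L σ) (hσ0 : σ 0 = 0) (A : Matrix m n ℝ)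
    (b : EuclideanSpace ℝ m) (z : EuclideanSpace ℝ n) :
    ‖affineLayer σ A b z‖ ≤ L * (‖A‖ * ‖z‖ + ‖b‖) := by
  have h : ‖affineLayer σ A b z‖ ≤ L * ‖WithLp.toLp 2 (A.mulVec z.ofLp) + b‖ :=
    norm_le_mul_norm_of_entries L.2 fun i => by
      have := hσ.dist_le_mul (A.mulVec z.ofLp i + b i) 0
      rwa [hσ0, dist_zero_right, dist_zero_right] at this
  refine h.trans ?_
  gcongr
  exact (norm_add_le _ _).trans (by gcongr; exact norm_toLp_mulVec_le A z)

/-- The splitting `A z - A' z' = (A - A') z + A' (z - z')` is deliberately asymmetric: it needs the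
size of one input `z` and one matrix `A'` only, so later estimates require a bound on just one of
the two trajectories. -/
theorem norm_affineLayer_sub_le (hσ : LipschitzWith L σ) (A A' : Matrix m n ℝ)
    (b b' : EuclideanSpace ℝ m) (z z' : EuclideanSpace ℝ n) :
    ‖affineLayer σ A b z - affineLayer σ A' b' z'‖ ≤
      L * (‖A - A'‖ * ‖z‖ + ‖A'‖ * ‖z - z'‖ + ‖b - b'‖) := by
  have h : ‖affineLayer σ A b z - affineLayer σ A' b' z'‖ ≤
      L * ‖WithLp.toLp 2 ((A - A').mulVec z.ofLp) + WithLp.toLp 2 (A'.mulVec (z - z').ofLp) +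
        (b - b')‖ :=
    norm_le_mul_norm_of_entries L.2 fun i => by
      have := hσ.dist_le_mul (A.mulVec z.ofLp i + b i) (A'.mulVec z'.ofLp i + b' i)
      rw [Real.dist_eq, Real.dist_eq] at this
      refine this.trans (le_of_eq ?_)
      simp only [PiLp.add_apply, PiLp.sub_apply, WithLp.ofLp_sub, Matrix.sub_mulVec,
        Matrix.mulVec_sub, Pi.sub_apply]
      congr 2
      ring
  refine h.trans ?_
  gcongr
  refine (norm_add_le _ _).trans ?_
  gcongr
  exact (norm_add_le _ _).trans
    (add_le_add (norm_toLp_mulVec_le _ z) (norm_toLp_mulVec_le _ (z - z')))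

end Affine

variable {d p q : ℕ}

theorem norm_mulV_le (A : Matrix (Fin p) (Fin d) ℝ) (x : EuclideanSpace ℝ (Fin d)) :
    ‖mulV A x‖ ≤ ‖A‖ * ‖x‖ := norm_toLp_mulVec_le A x

theorem layer_eq_affineLayer (σ : ℝ → ℝ) (A : Matrix (Fin p) (Fin d) ℝ)
    (b : EuclideanSpace ℝ (Fin p)) (z : EuclideanSpace ℝ (Fin d)) :
    layer σ A b z = affineLayer σ A b z := rfl

theorem mulV_sub (A : Matrix (Fin p) (Fin d) ℝ) (x y : EuclideanSpace ℝ (Fin d)) :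
    mulV A (x - y) = mulV A x - mulV A y := by
  simp [mulV, Matrix.mulVec_sub]

theorem mulV_add (A : Matrix (Fin p) (Fin d) ℝ) (x y : EuclideanSpace ℝ (Fin d)) :
    mulV A (x + y) = mulV A x + mulV A y := by
  simp [mulV, Matrix.mulVec_add]

theorem sub_mulV (A B : Matrix (Fin p) (Fin d) ℝ) (x : EuclideanSpace ℝ (Fin d)) :
    mulV (A - B) x = mulV A x - mulV B x := by
  simp [mulV, Matrix.sub_mulVec]

theorem isBoundedBilinearMap_mulV : IsBoundedBilinearMap ℝ
    fun M : Matrix (Fin p) (Fin d) ℝ × EuclideanSpace ℝ (Fin d) => mulV M.1 M.2 where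
  add_left A B x := by simp [mulV, Matrix.add_mulVec]
  smul_left c A x := by simp [mulV, Matrix.smul_mulVec]
  add_right A x y := mulV_add A x y
  smul_right c A x := by simp [mulV, Matrix.mulVec_smul]
  bound := ⟨1, one_pos, fun A x => by simpa using norm_mulV_le A x⟩

/-! ### Growth and Lipschitz estimates for the neural vector fields -/

namespace Bounds

variable (c : Bounds)

theorem β_nonneg (h : ℕ) : 0 ≤ c.β h := by unfold β; positivity

theorem β_succ (h : ℕ) : c.β (h + 1) = c.Lσ * c.BA * c.β h + c.Lσ * c.Bb := by
  unfold β
  rw [geom_sum_succ]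
  ring

/-- How much the vector fields of two sets of parameters can differ on the ball of radius `ρ`. -/
noncomputable def fieldGap (θ θ' : Params d p q) (ρ : ℝ) : ℝ :=
  ∑ h : Fin (q - 1), ((c.Lσ : ℝ) * c.BA) ^ (q - 1 - (h : ℕ)) * (c.Lσ *
    (‖θ.A h - θ'.A h‖ * (((c.Lσ : ℝ) * c.BA) ^ (h : ℕ) * ρ + c.β h) + ‖θ.b h - θ'.b h‖)) +
  c.Lσ * (‖θ.Alast - θ'.Alast‖ * (((c.Lσ : ℝ) * c.BA) ^ (q - 1) * ρ + c.β (q - 1)) +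
    ‖θ.blast - θ'.blast‖)

end Bounds

variable {c : Bounds} {σ : ℝ → ℝ}

theorem norm_foldl_layer_le (hσ : LipschitzWith c.Lσ σ) (hσ0 : σ 0 = 0) {n : ℕ}
    {A : Fin n → Matrix (Fin p) (Fin p) ℝ} {b : Fin n → EuclideanSpace ℝ (Fin p)}
    (hA : ∀ h, ‖A h‖ ≤ c.BA) (hb : ∀ h, ‖b h‖ ≤ c.Bb) (z : EuclideanSpace ℝ (Fin p)) :
    ‖Fin.foldl n (fun u h => layer σ (A h) (b h) u) z‖ ≤
      ((c.Lσ : ℝ) * c.BA) ^ n * ‖z‖ + c.β n := by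
  induction n with
  | zero => simp [Bounds.β]
  | succ n ih =>
    rw [Fin.foldl_succ_last, c.β_succ, layer_eq_affineLayer]
    have h1 := ih (fun h => hA h.castSucc) (fun h => hb h.castSucc)
    refine (norm_affineLayer_le hσ hσ0 _ _ _).trans ?_
    calc _ ≤ c.Lσ * (c.BA * (((c.Lσ : ℝ) * c.BA) ^ n * ‖z‖ + c.β n) + c.Bb) := by
          gcongr
          · exact hA _
          · exact hb _
      _ = _ := by ring

/-- A change in the layer of index `h` acts on an input of size at most `(Lσ BA)^h ‖z‖ + β_h`, and
the `n - 1 - h` layers above it each amplify the error by at most `Lσ BA`. The induction peels off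
the last layer. -/
theorem norm_foldl_layer_sub_le (hσ : LipschitzWith c.Lσ σ) (hσ0 : σ 0 = 0) {n : ℕ}
    {A A' : Fin n → Matrix (Fin p) (Fin p) ℝ} {b b' : Fin n → EuclideanSpace ℝ (Fin p)}
    (hA : ∀ h, ‖A h‖ ≤ c.BA) (hb : ∀ h, ‖b h‖ ≤ c.Bb) (hA' : ∀ h, ‖A' h‖ ≤ c.BA)
    (z z' : EuclideanSpace ℝ (Fin p)) :
    ‖Fin.foldl n (fun u h => layer σ (A h) (b h) u) z -
        Fin.foldl n (fun u h => layer σ (A' h) (b' h) u) z'‖ ≤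
      ((c.Lσ : ℝ) * c.BA) ^ n * ‖z - z'‖ +
        ∑ h : Fin n, ((c.Lσ : ℝ) * c.BA) ^ (n - 1 - (h : ℕ)) * (c.Lσ *
          (‖A h - A' h‖ * (((c.Lσ : ℝ) * c.BA) ^ (h : ℕ) * ‖z‖ + c.β h) + ‖b h - b' h‖)) := by
  induction n with
  | zero => simp
  | succ n ih =>
    rw [Fin.foldl_succ_last, Fin.foldl_succ_last, Fin.sum_univ_castSucc, layer_eq_affineLayer,
      layer_eq_affineLayer]
    have h1 := ih (fun h => hA h.castSucc) (fun h => hb h.castSucc) (fun h => hA' h.castSucc)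
      (b' := fun h => b' h.castSucc)
    have h2 := norm_foldl_layer_le hσ hσ0 (fun h => hA h.castSucc) (fun h => hb h.castSucc) z
    refine (norm_affineLayer_sub_le hσ _ _ _ _ _ _).trans ?_
    set S := ∑ h : Fin n, ((c.Lσ : ℝ) * c.BA) ^ (n - 1 - (h : ℕ)) * (c.Lσ *
      (‖A h.castSucc - A' h.castSucc‖ * (((c.Lσ : ℝ) * c.BA) ^ (h : ℕ) * ‖z‖ + c.β h) +
        ‖b h.castSucc - b' h.castSucc‖)) with hS
    have h3 : ∑ h : Fin n, ((c.Lσ : ℝ) * c.BA) ^ (n + 1 - 1 - (h.castSucc : ℕ)) * (c.Lσ *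
      (‖A h.castSucc - A' h.castSucc‖ * (((c.Lσ : ℝ) * c.BA) ^ (h.castSucc : ℕ) * ‖z‖ +
        c.β h.castSucc) + ‖b h.castSucc - b' h.castSucc‖)) = c.Lσ * c.BA * S := by
      rw [hS, Finset.mul_sum]
      refine Finset.sum_congr rfl fun h _ => ?_
      have e : n + 1 - 1 - (h.castSucc : ℕ) = n - 1 - (h : ℕ) + 1 := by
        have := h.2
        simp only [Fin.val_castSucc]
        omega
      rw [e, pow_succ]
      simp only [Fin.val_castSucc]
      ring
    rw [h3]
    simp only [Fin.val_last, Nat.add_sub_cancel, Nat.sub_self, pow_zero, one_mul]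
    calc _ ≤ c.Lσ * (‖A (Fin.last n) - A' (Fin.last n)‖ *
            (((c.Lσ : ℝ) * c.BA) ^ n * ‖z‖ + c.β n) +
          c.BA * (((c.Lσ : ℝ) * c.BA) ^ n * ‖z - z'‖ + S) +
          ‖b (Fin.last n) - b' (Fin.last n)‖) := by
          gcongr
          exact hA' _
      _ = _ := by ring

theorem vec_field (θ : Params d p q) (z : EuclideanSpace ℝ (Fin p)) :
    vec (θ.field σ z) = affineLayer σ θ.Alast (vec θ.blast) (θ.hidden σ z) := rfl

theorem norm_field_le (hq : 1 ≤ q) (hσ : LipschitzWith c.Lσ σ) (hσ0 : σ 0 = 0) {θ : Params d p q}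
    (hθ : θ ∈ paramSet d p q c) (z : EuclideanSpace ℝ (Fin p)) :
    ‖θ.field σ z‖ ≤ c.lipField q * ‖z‖ + c.κ q := by
  obtain ⟨m, rfl⟩ := Nat.exists_eq_add_of_le' hq
  obtain ⟨-, hA, hb, hAl, hbl, -⟩ := hθ
  have h1 : ‖θ.hidden σ z‖ ≤ _ := norm_foldl_layer_le hσ hσ0 hA hb z
  rw [Nat.add_sub_cancel] at h1
  rw [← norm_vec, vec_field]
  refine (norm_affineLayer_le hσ hσ0 _ _ _).trans ?_
  rw [norm_vec, Bounds.κ, c.β_succ, Bounds.lipField]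
  calc _ ≤ c.Lσ * (c.BA * (((c.Lσ : ℝ) * c.BA) ^ m * ‖z‖ + c.β m) + c.Bb) := by gcongr
    _ = _ := by ring

/-- The last layer, with its output flattened by `vec`, is one more affine layer on top of the
hidden ones. `lipField` multiplies the change of state, and every change of parameters goes into
`fieldGap`. -/
theorem norm_field_sub_le (hq : 1 ≤ q) (hσ : LipschitzWith c.Lσ σ) (hσ0 : σ 0 = 0)
    {θ θ' : Params d p q} (hθ : θ ∈ paramSet d p q c) (hθ' : θ' ∈ paramSet d p q c)
    (z z' : EuclideanSpace ℝ (Fin p)) :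
    ‖θ.field σ z - θ'.field σ z'‖ ≤ c.lipField q * ‖z - z'‖ + c.fieldGap θ θ' ‖z‖ := by
  obtain ⟨m, rfl⟩ := Nat.exists_eq_add_of_le' hq
  obtain ⟨-, hA, hb, hAl, hbl, -⟩ := hθ
  obtain ⟨-, hA', hb', hAl', hbl', -⟩ := hθ'
  have h1 : ‖θ.hidden σ z‖ ≤ _ := norm_foldl_layer_le hσ hσ0 hA hb z
  have h2 : ‖θ.hidden σ z - θ'.hidden σ z'‖ ≤ _ :=
    norm_foldl_layer_sub_le hσ hσ0 hA hb hA' z z' (b' := θ'.b)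
  rw [← norm_vec, vec_sub, vec_field, vec_field]
  refine (norm_affineLayer_sub_le hσ _ _ _ _ _ _).trans ?_
  rw [← vec_sub, norm_vec, Bounds.lipField, Bounds.fieldGap]
  set S := ∑ h : Fin (m + 1 - 1), ((c.Lσ : ℝ) * c.BA) ^ (m + 1 - 1 - 1 - (h : ℕ)) * (c.Lσ *
    (‖θ.A h - θ'.A h‖ * (((c.Lσ : ℝ) * c.BA) ^ (h : ℕ) * ‖z‖ + c.β h) + ‖θ.b h - θ'.b h‖)) with hS
  have h3 : ∑ h : Fin (m + 1 - 1), ((c.Lσ : ℝ) * c.BA) ^ (m + 1 - 1 - (h : ℕ)) * (c.Lσ *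
    (‖θ.A h - θ'.A h‖ * (((c.Lσ : ℝ) * c.BA) ^ (h : ℕ) * ‖z‖ + c.β h) + ‖θ.b h - θ'.b h‖)) =
      c.Lσ * c.BA * S := by
    rw [hS, Finset.mul_sum]
    refine Finset.sum_congr rfl fun h _ => ?_
    have e : m + 1 - 1 - (h : ℕ) = m + 1 - 1 - 1 - (h : ℕ) + 1 := by
      have := h.2
      omega
    rw [e, pow_succ]
    ring
  rw [h3]
  rw [Nat.add_sub_cancel] at h1 h2 ⊢
  calc _ ≤ c.Lσ * (‖θ.Alast - θ'.Alast‖ * (((c.Lσ : ℝ) * c.BA) ^ m * ‖z‖ + c.β m) +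
        c.BA * (((c.Lσ : ℝ) * c.BA) ^ m * ‖z - z'‖ + S) + ‖θ.blast - θ'.blast‖) := by
        gcongr
    _ = _ := by ring

theorem fieldGap_mono (θ θ' : Params d p q) {r ρ : ℝ} (h : r ≤ ρ) :
    c.fieldGap θ θ' r ≤ c.fieldGap θ θ' ρ := by
  unfold Bounds.fieldGap
  gcongr

theorem fieldGap_nonneg (θ θ' : Params d p q) {ρ : ℝ} (hρ : 0 ≤ ρ) : 0 ≤ c.fieldGap θ θ' ρ := by
  have := c.β_nonneg
  unfold Bounds.fieldGap
  refine add_nonneg (Finset.sum_nonneg fun h _ => ?_) ?_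
  · have := this h
    positivity
  · have := this (q - 1)
    positivity

theorem fieldGap_self (θ : Params d p q) (ρ : ℝ) : c.fieldGap θ θ ρ = 0 := by
  simp [Bounds.fieldGap]

theorem norm_init_le (hσ : LipschitzWith c.Lσ σ) (hσ0 : σ 0 = 0) {θ : Params d p q}
    (hθ : θ ∈ paramSet d p q c) {x : EuclideanSpace ℝ (Fin d)} (hx : ‖x‖ ≤ c.Bx) :
    ‖θ.init σ x‖ ≤ c.Lσ * (c.BU * c.Bx + c.Bv) := by
  obtain ⟨-, -, -, -, -, hU, hv⟩ := hθ
  rw [Params.init, layer_eq_affineLayer]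
  refine (norm_affineLayer_le hσ hσ0 _ _ _).trans ?_
  gcongr

theorem norm_init_sub_le (hσ : LipschitzWith c.Lσ σ) (θ θ' : Params d p q)
    {x : EuclideanSpace ℝ (Fin d)} (hx : ‖x‖ ≤ c.Bx) :
    ‖θ.init σ x - θ'.init σ x‖ ≤ c.Lσ * (‖θ.U - θ'.U‖ * c.Bx + ‖θ.v - θ'.v‖) := by
  rw [Params.init, Params.init, layer_eq_affineLayer, layer_eq_affineLayer]
  refine (norm_affineLayer_sub_le hσ _ _ _ _ _ _).trans ?_
  rw [sub_self, norm_zero, mul_zero, add_zero]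
  gcongr

end Network

/-! ### Discrete Grönwall inequality -/

theorem monotone_prod_one_add {u : ℕ → ℝ} (hu : ∀ k, 0 ≤ u k) :
    Monotone fun k => ∏ j ∈ Finset.range k, (1 + u j) :=
  monotone_nat_of_le_succ fun k => by
    rw [Finset.prod_range_succ]
    exact le_mul_of_one_le_right (Finset.prod_nonneg fun j _ => by linarith [hu j])
      (by linarith [hu k])

/-- Each product is at least 1, so every source term `w j` may be charged the full product. This
keeps the bound in closed form. -/
theorem discrete_gronwall {a u w : ℕ → ℝ} {K : ℕ} (hu : ∀ k, 0 ≤ u k) (hw : ∀ k, 0 ≤ w k)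
    (h : ∀ k < K, a (k + 1) ≤ (1 + u k) * a k + w k) :
    ∀ k ≤ K, a k ≤ (a 0 + ∑ j ∈ Finset.range k, w j) * ∏ j ∈ Finset.range k, (1 + u j) := by
  intro k
  induction k with
  | zero => simp
  | succ k ih =>
    intro hk
    have h1 := ih (by omega)
    have h2 := h k (by omega)
    rw [Finset.sum_range_succ, Finset.prod_range_succ]
    have h4 : 1 ≤ (∏ j ∈ Finset.range k, (1 + u j)) * (1 + u k) := by
      rw [← Finset.prod_range_succ]
      simpa using monotone_prod_one_add hu (Nat.zero_le (k + 1))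
    have h5 := mul_le_mul_of_nonneg_left h1 (by linarith [hu k] : 0 ≤ 1 + u k)
    have h6 := mul_le_mul_of_nonneg_left h4 (hw k)
    nlinarith

theorem prod_one_add_le_exp {u : ℕ → ℝ} (hu : ∀ k, 0 ≤ u k) (k : ℕ) :
    ∏ j ∈ Finset.range k, (1 + u j) ≤ Real.exp (∑ j ∈ Finset.range k, u j) := by
  rw [Real.exp_sum]
  exact Finset.prod_le_prod (fun j _ => by linarith [hu j]) fun j _ => by
    linarith [Real.add_one_le_exp (u j)]

/-- Exposes the intermediate states of a fold as a sequence on `ℕ`, the form in which the Grönwall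
estimates apply to ResNets. -/
theorem foldl_eq_sequence {α : Type*} {n : ℕ} (f : α → Fin n → α) (a : α) :
    ∃ z : ℕ → α, z 0 = a ∧ (∀ k (h : k < n), z (k + 1) = f (z k) ⟨k, h⟩) ∧
      z n = Fin.foldl n f a := by
  induction n with
  | zero => exact ⟨fun _ => a, rfl, fun k h => absurd h (by omega), by simp⟩
  | succ n ih =>
    obtain ⟨z, h0, h1, h2⟩ := ih fun a i => f a i.castSucc
    refine ⟨fun k => if k ≤ n then z k else Fin.foldl (n + 1) f a, by simpa using h0, ?_, by simp⟩
    intro k hk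
    rcases Nat.lt_succ_iff_lt_or_eq.1 hk with h | rfl
    · simp only [Nat.succ_le_of_lt h, h.le, if_true]
      exact h1 k h
    · simp only [Nat.not_succ_le_self, if_false, le_refl, if_true]
      rw [Fin.foldl_succ_last, h2]
      rfl

/-! ### Euler schemes along a Lipschitz driver -/

section Euler

attribute [local instance] Matrix.frobeniusNormedAddCommGroup Matrix.frobeniusNormedSpace

variable {d p : ℕ} {G G' : EuclideanSpace ℝ (Fin p) → Matrix (Fin p) (Fin d) ℝ}
  {y : ℕ → EuclideanSpace ℝ (Fin d)} {z z' : ℕ → EuclideanSpace ℝ (Fin p)} {t : ℕ → ℝ}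
  {l b L ρ δ : ℝ} {K : ℕ}

/-- Growth of the states of an Euler scheme. -/
theorem norm_euler_le (hl : 0 ≤ l) (hb : 0 ≤ b) (hL : 0 ≤ L) (hG : ∀ u, ‖G u‖ ≤ l * ‖u‖ + b)
    (ht : Monotone t) (hy : ∀ k < K, ‖y (k + 1) - y k‖ ≤ L * (t (k + 1) - t k))
    (hz : ∀ k < K, z (k + 1) = z k + mulV (G (z k)) (y (k + 1) - y k)) {k : ℕ} (hk : k ≤ K) :
    ‖z k‖ ≤ (‖z 0‖ + b * L * (t K - t 0)) *
      ∏ j ∈ Finset.range K, (1 + l * L * (t (j + 1) - t j)) := by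
  have hΔ : ∀ k, 0 ≤ t (k + 1) - t k := fun k => sub_nonneg.2 (ht k.le_succ)
  have hu : ∀ k, 0 ≤ l * L * (t (k + 1) - t k) := fun k => mul_nonneg (by positivity) (hΔ k)
  have hw : ∀ k, 0 ≤ b * L * (t (k + 1) - t k) := fun k => mul_nonneg (by positivity) (hΔ k)
  have h := discrete_gronwall (a := fun k => ‖z k‖) (K := K) hu hw (fun k hk => by
    rw [hz k hk]
    refine (norm_add_le _ _).trans ?_
    have h1 : ‖mulV (G (z k)) (y (k + 1) - y k)‖ ≤
        (l * ‖z k‖ + b) * (L * (t (k + 1) - t k)) :=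
      (norm_mulV_le _ _).trans
        (mul_le_mul (hG _) (hy k hk) (norm_nonneg _) (by positivity))
    linarith) k hk
  refine h.trans ?_
  have h2 : ∑ j ∈ Finset.range k, b * L * (t (j + 1) - t j) ≤ b * L * (t K - t 0) := by
    rw [← Finset.mul_sum, Finset.sum_range_sub]
    have := ht hk
    gcongr
  have h3 : ∏ j ∈ Finset.range k, (1 + l * L * (t (j + 1) - t j)) ≤
      ∏ j ∈ Finset.range K, (1 + l * L * (t (j + 1) - t j)) := monotone_prod_one_add hu hk
  have h4 : 0 ≤ ∏ j ∈ Finset.range k, (1 + l * L * (t (j + 1) - t j)) :=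
    Finset.prod_nonneg fun j _ => by linarith [hu j]
  have h5 : 0 ≤ b * L * (t K - t 0) := mul_nonneg (by positivity) (sub_nonneg.2 (ht K.zero_le))
  gcongr

theorem prod_one_add_le_exp_mul (hl : 0 ≤ l) (hL : 0 ≤ L) (ht : Monotone t) (K : ℕ) :
    ∏ j ∈ Finset.range K, (1 + l * L * (t (j + 1) - t j)) ≤ Real.exp (l * L * (t K - t 0)) := by
  rw [← Finset.sum_range_sub, Finset.mul_sum]
  exact prod_one_add_le_exp (fun j => mul_nonneg (by positivity)
    (sub_nonneg.2 (ht j.le_succ))) K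

/-- Stability of Euler schemes with respect to the vector field and the initial condition. -/
theorem norm_euler_sub_le (hl : 0 ≤ l) (hL : 0 ≤ L) (hδ : 0 ≤ δ)
    (hG : ∀ u u', ‖u‖ ≤ ρ → ‖G u - G' u'‖ ≤ l * ‖u - u'‖ + δ)
    (ht : Monotone t) (hy : ∀ k < K, ‖y (k + 1) - y k‖ ≤ L * (t (k + 1) - t k))
    (hz : ∀ k < K, z (k + 1) = z k + mulV (G (z k)) (y (k + 1) - y k))
    (hz' : ∀ k < K, z' (k + 1) = z' k + mulV (G' (z' k)) (y (k + 1) - y k))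
    (hρ : ∀ k ≤ K, ‖z k‖ ≤ ρ) :
    ‖z K - z' K‖ ≤ (‖z 0 - z' 0‖ + δ * L * (t K - t 0)) * Real.exp (l * L * (t K - t 0)) := by
  have hΔ : ∀ k, 0 ≤ t (k + 1) - t k := fun k => sub_nonneg.2 (ht k.le_succ)
  have hu : ∀ k, 0 ≤ l * L * (t (k + 1) - t k) := fun k => mul_nonneg (by positivity) (hΔ k)
  have hw : ∀ k, 0 ≤ δ * L * (t (k + 1) - t k) := fun k => mul_nonneg (by positivity) (hΔ k)
  have h := discrete_gronwall (a := fun k => ‖z k - z' k‖) (K := K) hu hw (fun k hk => by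
    rw [hz k hk, hz' k hk, add_sub_add_comm, ← sub_mulV]
    refine (norm_add_le _ _).trans ?_
    have h1 : ‖mulV (G (z k) - G' (z' k)) (y (k + 1) - y k)‖ ≤
        (l * ‖z k - z' k‖ + δ) * (L * (t (k + 1) - t k)) :=
      (norm_mulV_le _ _).trans
        (mul_le_mul (hG _ _ (hρ k hk.le)) (hy k hk) (norm_nonneg _) (by positivity))
    linarith) K le_rfl
  rw [← Finset.mul_sum, Finset.sum_range_sub] at h
  refine h.trans ?_
  have : 0 ≤ δ * L * (t K - t 0) := mul_nonneg (by positivity) (sub_nonneg.2 (ht K.zero_le))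
  gcongr
  exact prod_one_add_le_exp_mul hl hL ht K

/-- Over a window, the states of an Euler scheme move linearly up to a quadratic error. -/
theorem norm_euler_local_le (hl : 0 ≤ l) (hL : 0 ≤ L) {M : ℝ} (hM : 0 ≤ M)
    (hG : ∀ u u', ‖G u - G u'‖ ≤ l * ‖u - u'‖)
    (ht : Monotone t) (hy : ∀ k < K, ‖y (k + 1) - y k‖ ≤ L * (t (k + 1) - t k))
    (hz : ∀ k < K, z (k + 1) = z k + mulV (G (z k)) (y (k + 1) - y k))
    (hM' : ∀ k ≤ K, ‖G (z k)‖ ≤ M) {k m : ℕ} (hkm : k ≤ m) (hm : m ≤ K) :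
    ‖z m - z k‖ ≤ M * L * (t m - t k) ∧
      ‖z m - z k - mulV (G (z k)) (y m - y k)‖ ≤ l * M * L ^ 2 * (t m - t k) ^ 2 := by
  induction m, hkm using Nat.le_induction with
  | base => simp [mulV]
  | succ m hkm ih =>
    obtain ⟨h1, h2⟩ := ih (by omega)
    have hΔ : 0 ≤ t (m + 1) - t m := sub_nonneg.2 (ht m.le_succ)
    have hΔ' : 0 ≤ t m - t k := sub_nonneg.2 (ht hkm)
    have hy' := hy m (by omega)
    have h3 : ‖mulV (G (z m)) (y (m + 1) - y m)‖ ≤ M * (L * (t (m + 1) - t m)) :=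
      (norm_mulV_le _ _).trans (mul_le_mul (hM' m (by omega)) hy' (norm_nonneg _) hM)
    have h4 : ‖mulV (G (z m) - G (z k)) (y (m + 1) - y m)‖ ≤
        (l * (M * L * (t m - t k))) * (L * (t (m + 1) - t m)) :=
      (norm_mulV_le _ _).trans (mul_le_mul ((hG _ _).trans (by gcongr)) hy' (norm_nonneg _)
        (by positivity))
    rw [hz m (by omega)]
    constructor
    · rw [add_sub_right_comm]
      refine (norm_add_le _ _).trans ?_
      linarith
    -- The new error is the old one plus `G (z m) - G (z k)` applied to one increment of `y`. The
    -- second is at most `l M L² a b`, with `a` the elapsed time and `b` the new step, and `a² + a b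
    -- ≤ (a + b)²` closes the induction.
    · have e : z m + mulV (G (z m)) (y (m + 1) - y m) - z k - mulV (G (z k)) (y (m + 1) - y k) =
          (z m - z k - mulV (G (z k)) (y m - y k)) +
            mulV (G (z m) - G (z k)) (y (m + 1) - y m) := by
        rw [sub_mulV, ← sub_add_sub_cancel (y (m + 1)) (y m) (y k), mulV_add]
        abel
      rw [e]
      refine (norm_add_le _ _).trans ?_
      have h5 : 0 ≤ l * M * L ^ 2 * ((t m - t k) * (t (m + 1) - t m)) := by positivity
      have h6 : 0 ≤ l * M * L ^ 2 * (t (m + 1) - t m) ^ 2 := by positivity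
      nlinarith

end Euler

/-! ### Controlled differential equations -/

section CDE

attribute [local instance] Matrix.frobeniusNormedAddCommGroup Matrix.frobeniusNormedSpace

open Filter Topology

variable {d p : ℕ} {G : EuclideanSpace ℝ (Fin p) → Matrix (Fin p) (Fin d) ℝ}
  {x : ℝ → EuclideanSpace ℝ (Fin d)} {z w : ℝ → EuclideanSpace ℝ (Fin p)}
  {L : ℝ≥0} {l b C : ℝ}

/-- `z` is driven by `G(z) dx` on `[0,1]`, up to quadratic local errors. -/
def IsDriven (G : EuclideanSpace ℝ (Fin p) → Matrix (Fin p) (Fin d) ℝ)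
    (x : ℝ → EuclideanSpace ℝ (Fin d)) (z : ℝ → EuclideanSpace ℝ (Fin p)) (C : ℝ) : Prop :=
  ∀ s t, 0 ≤ s → s ≤ t → t ≤ 1 → ‖z t - z s - mulV (G (z s)) (x t - x s)‖ ≤ C * (t - s) ^ 2

theorem norm_sub_le_of_lipschitzOnWith (hx : LipschitzOnWith L x (Set.Icc 0 1)) {s t : ℝ}
    (hs : 0 ≤ s) (hst : s ≤ t) (ht : t ≤ 1) : ‖x t - x s‖ ≤ L * (t - s) := by
  have := hx.dist_le_mul t ⟨hs.trans hst, ht⟩ s ⟨hs, hst.trans ht⟩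
  rwa [dist_eq_norm, Real.dist_eq, abs_of_nonneg (sub_nonneg.2 hst)] at this

/-- Cut `[0, t]` into `N` equal steps. The `N` local errors of order `1 / N²` add up to `O(1 / N)`,
Grönwall amplifies them by at most `exp (l L)`, and `N → ∞`. -/
theorem IsDriven.eqOn (hx : LipschitzOnWith L x (Set.Icc 0 1)) (hl : 0 ≤ l)
    (hG : ∀ u u', ‖G u - G u'‖ ≤ l * ‖u - u'‖) {C' : ℝ} (hC : 0 ≤ C) (hC' : 0 ≤ C')
    (hz : IsDriven G x z C) (hw : IsDriven G x w C') (h0 : z 0 = w 0) :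
    Set.EqOn z w (Set.Icc 0 1) := by
  rintro t ⟨ht0, ht1⟩
  have key : ∀ N : ℕ, 0 < N → ‖z t - w t‖ ≤ (C + C') * Real.exp (l * L) * (1 / N) := by
    intro N hN
    have hN0 : (0 : ℝ) < N := by exact_mod_cast hN
    set u : ℕ → ℝ := fun k => t * (k / N) with hu
    have hu1 : ∀ k, u (k + 1) - u k = t / N := fun k => by
      simp only [hu]; push_cast; field_simp; ring
    have hule : ∀ k ≤ N, u k ≤ 1 := fun k hk => by
      have : (k : ℝ) / N ≤ 1 := by
        rw [div_le_one hN0]; exact_mod_cast hk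
      simp only [hu]
      exact mul_le_one₀ ht1 (by positivity) this
    have htN : 0 ≤ t / N := by positivity
    have h := discrete_gronwall (a := fun k => ‖z (u k) - w (u k)‖) (K := N)
      (u := fun _ => l * L * (t / N)) (w := fun _ => (C + C') * (t / N) ^ 2)
      (fun _ => by positivity) (fun _ => by positivity) (fun k hk => by
        have hk0 : 0 ≤ u k := by simp only [hu]; positivity
        have hk1 : u k ≤ u (k + 1) := by linarith [hu1 k]
        have hk2 := hule (k + 1) hk
        have e1 := hz _ _ hk0 hk1 hk2
        have e2 := hw _ _ hk0 hk1 hk2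
        have e3 := norm_sub_le_of_lipschitzOnWith hx hk0 hk1 hk2
        rw [hu1] at e1 e2 e3
        have e4 : ‖mulV (G (z (u k)) - G (w (u k))) (x (u (k + 1)) - x (u k))‖ ≤
            l * ‖z (u k) - w (u k)‖ * (L * (t / N)) :=
          (norm_mulV_le _ _).trans (mul_le_mul (hG _ _) e3 (norm_nonneg _) (by positivity))
        have e5 : z (u (k + 1)) - w (u (k + 1)) = (z (u k) - w (u k)) +
            mulV (G (z (u k)) - G (w (u k))) (x (u (k + 1)) - x (u k)) +
            (z (u (k + 1)) - z (u k) - mulV (G (z (u k))) (x (u (k + 1)) - x (u k))) -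
            (w (u (k + 1)) - w (u k) - mulV (G (w (u k))) (x (u (k + 1)) - x (u k))) := by
          rw [sub_mulV]; abel
        have e6 := norm_sub_le ((z (u k) - w (u k)) +
            mulV (G (z (u k)) - G (w (u k))) (x (u (k + 1)) - x (u k)) +
            (z (u (k + 1)) - z (u k) - mulV (G (z (u k))) (x (u (k + 1)) - x (u k))))
            (w (u (k + 1)) - w (u k) - mulV (G (w (u k))) (x (u (k + 1)) - x (u k)))
        have e7 := norm_add₃_le (a := z (u k) - w (u k))
            (b := mulV (G (z (u k)) - G (w (u k))) (x (u (k + 1)) - x (u k)))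
            (c := z (u (k + 1)) - z (u k) - mulV (G (z (u k))) (x (u (k + 1)) - x (u k)))
        rw [← e5] at e6
        linarith) N le_rfl
    have h2 : ∏ _j ∈ Finset.range N, (1 + l * L * (t / N)) ≤ Real.exp (l * L) := by
      refine (prod_one_add_le_exp (u := fun _ => l * L * (t / N)) (fun _ => by positivity) N).trans
        (Real.exp_le_exp.2 ?_)
      rw [Finset.sum_const, Finset.card_range, nsmul_eq_mul]
      have : (N : ℝ) * (l * L * (t / N)) = l * L * t := by field_simp
      rw [this]
      exact mul_le_of_le_one_right (by positivity) ht1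
    have hu0 : u 0 = 0 := by simp [hu]
    have huN : u N = t := by simp only [hu]; field_simp
    have h3 : ∑ _j ∈ Finset.range N, (C + C') * (t / N) ^ 2 ≤ (C + C') * (1 / N) := by
      rw [Finset.sum_const, Finset.card_range, nsmul_eq_mul]
      have : (N : ℝ) * ((C + C') * (t / N) ^ 2) = (C + C') * (t ^ 2 * (1 / N)) := by field_simp
      rw [this]
      gcongr
      exact mul_le_of_le_one_left (by positivity) (pow_le_one₀ ht0 ht1)
    simp only [hu0, huN, h0, sub_self, norm_zero, zero_add] at h
    calc _ ≤ _ := h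
      _ ≤ (C + C') * (1 / N) * Real.exp (l * L) := by
        refine mul_le_mul h3 h2 (Finset.prod_nonneg fun _ _ => by positivity) (by positivity)
      _ = _ := by ring
  have hlim : Tendsto (fun N : ℕ => (C + C') * Real.exp (l * L) * (1 / (N : ℝ))) atTop (𝓝 0) := by
    rw [← mul_zero ((C + C') * Real.exp (l * L))]
    exact tendsto_one_div_atTop_nhds_zero_nat.const_mul _
  have := ge_of_tendsto hlim ((eventually_gt_atTop 0).mono key)
  exact sub_eq_zero.1 (norm_le_zero_iff.1 this)

/-- Additivity and domination of Riemann-Stieltjes integrals against a Lipschitz integrator. -/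
theorem norm_sub_le_of_hasRSIntegral (hx : LipschitzOnWith L x (Set.Icc 0 1))
    {f : ℝ → Matrix (Fin p) (Fin d) ℝ} {s t : ℝ} (hs : 0 ≤ s) (hst : s ≤ t) (ht : t ≤ 1)
    {I J : EuclideanSpace ℝ (Fin p)} (hI : HasRSIntegral f x 0 s I) (hJ : HasRSIntegral f x 0 t J)
    (M : Matrix (Fin p) (Fin d) ℝ) {ω : ℝ} (hM : ∀ u ∈ Set.Icc s t, ‖f u - M‖ ≤ ω) :
    ‖J - I - mulV M (x t - x s)‖ ≤ ω * (L * (t - s)) := by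
  refine le_of_forall_pos_le_add fun ε hε => ?_
  obtain ⟨δ₁, hδ₁, h1⟩ := hI (ε / 2) (by positivity)
  obtain ⟨δ₂, hδ₂, h2⟩ := hJ (ε / 2) (by positivity)
  obtain ⟨N, hN⟩ := exists_nat_gt (1 / min δ₁ δ₂)
  have hmin : 0 < min δ₁ δ₂ := lt_min hδ₁ hδ₂
  have hN0 : (0 : ℝ) < N := lt_trans (by positivity) hN
  have hNδ : 1 / (N : ℝ) < min δ₁ δ₂ := by
    rw [div_lt_comm₀ hN0 hmin]; exact hN
  have hω : 0 ≤ ω := (norm_nonneg _).trans (hM s ⟨le_rfl, hst⟩)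
  -- One sequence serves both integrals: its first `N` steps partition `[0, s]` and the next `N`
  -- partition `[s, t]`. The truncations by `min` and by natural subtraction switch between the two
  -- regimes.
  set u : ℕ → ℝ := fun k => s * ((min k N : ℕ) / N) + (t - s) * ((k - N : ℕ) / N) with hu
  have humono : Monotone u := by
    intro a b hab
    have h3 : ((min a N : ℕ) : ℝ) ≤ (min b N : ℕ) := by exact_mod_cast min_le_min_right N hab
    have h4 : ((a - N : ℕ) : ℝ) ≤ (b - N : ℕ) := by exact_mod_cast Nat.sub_le_sub_right hab N
    have := sub_nonneg.2 hst
    simp only [hu]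
    gcongr
  have hu0 : u 0 = 0 := by simp [hu]
  have huN : u N = s := by simp [hu, hN0.ne']
  have hu2N : u (N + N) = t := by simp [hu, hN0.ne']
  have hstep : ∀ k, u (k + 1) - u k ≤ 1 / N := by
    intro k
    simp only [hu]
    have hts : t - s ≤ 1 := by linarith
    have hN1 : 0 ≤ 1 / (N : ℝ) := by positivity
    rcases lt_or_ge k N with h | h
    · have e1 : min (k + 1) N = k + 1 := by omega
      have e2 : min k N = k := by omega
      have e3 : k + 1 - N = 0 := by omega
      have e4 : k - N = 0 := by omega
      rw [e1, e2, e3, e4]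
      have : s * (((k + 1 : ℕ) : ℝ) / N) + (t - s) * ((0 : ℕ) / N) -
          (s * ((k : ℝ) / N) + (t - s) * ((0 : ℕ) / N)) = s * (1 / N) := by
        push_cast; field_simp; ring
      rw [this]
      exact mul_le_of_le_one_left hN1 (hst.trans ht)
    · have e1 : min (k + 1) N = N := by omega
      have e2 : min k N = N := by omega
      have e3 : k + 1 - N = (k - N) + 1 := by omega
      rw [e1, e2, e3]
      have : s * ((N : ℝ) / N) + (t - s) * (((k - N + 1 : ℕ) : ℝ) / N) -
          (s * ((N : ℝ) / N) + (t - s) * ((k - N : ℕ) / N)) = (t - s) * (1 / N) := by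
        push_cast; field_simp; ring
      rw [this]
      exact mul_le_of_le_one_left hN1 hts
  have htag : ∀ k, u k ∈ Set.Icc (u k) (u (k + 1)) := fun k => ⟨le_rfl, humono k.le_succ⟩
  have g1 := h1 N u u humono hu0 huN (fun k _ => htag k)
    (fun k _ => (hstep k).trans_lt (hNδ.trans_le (min_le_left _ _)))
  have g2 := h2 (N + N) u u humono hu0 hu2N (fun k _ => htag k)
    (fun k _ => (hstep k).trans_lt (hNδ.trans_le (min_le_right _ _)))
  rw [Finset.sum_range_add] at g2
  set A := ∑ k ∈ Finset.range N, mulV (f (u k)) (x (u (k + 1)) - x (u k)) with hA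
  set B := ∑ k ∈ Finset.range N, mulV (f (u (N + k))) (x (u (N + k + 1)) - x (u (N + k))) with hB
  have hMsum : mulV M (x t - x s) =
      ∑ k ∈ Finset.range N, mulV M (x (u (N + k + 1)) - x (u (N + k))) := by
    simp only [mulV_sub, add_assoc]
    rw [Finset.sum_range_sub (fun k => mulV M (x (u (N + k)))), add_zero, hu2N, huN]
  have g3 : ‖B - mulV M (x t - x s)‖ ≤ ω * (L * (t - s)) := by
    rw [hMsum, hB, ← Finset.sum_sub_distrib]
    refine (norm_sum_le _ _).trans ?_
    calc _ ≤ ∑ k ∈ Finset.range N, ω * (L * (u (N + k + 1) - u (N + k))) := by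
          refine Finset.sum_le_sum fun k hk => ?_
          rw [← sub_mulV]
          have hk' := Finset.mem_range.1 hk
          have a1 : s ≤ u (N + k) := huN ▸ humono (Nat.le_add_right N k)
          have a2 : u (N + k) ≤ u (N + k + 1) := humono (Nat.le_succ _)
          have a3 : u (N + k + 1) ≤ t := hu2N ▸ humono (by omega : N + k + 1 ≤ N + N)
          exact (norm_mulV_le _ _).trans (mul_le_mul (hM _ ⟨a1, a2.trans a3⟩)
            (norm_sub_le_of_lipschitzOnWith hx (hs.trans a1) a2 (a3.trans ht)) (norm_nonneg _) hω)
      _ = ω * (L * (t - s)) := by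
          simp only [add_assoc]
          rw [← Finset.mul_sum, ← Finset.mul_sum, Finset.sum_range_sub (fun k => u (N + k)),
            add_zero, hu2N, huN]
  have e : J - I - mulV M (x t - x s) =
      (A - I) - (A + B - J) + (B - mulV M (x t - x s)) := by abel
  rw [e]
  have g4 := norm_add_le ((A - I) - (A + B - J)) (B - mulV M (x t - x s))
  have g5 := norm_sub_le (A - I) (A + B - J)
  linarith

/-- Solutions in the Riemann-Stieltjes sense have quadratic local errors. -/
theorem exists_isDriven_of_hasRSIntegral (hx : LipschitzOnWith L x (Set.Icc 0 1)) (hl : 0 ≤ l)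
    (hb : 0 ≤ b) (hG : ∀ u u', ‖G u - G u'‖ ≤ l * ‖u - u'‖) (hGb : ∀ u, ‖G u‖ ≤ l * ‖u‖ + b)
    (hzc : ContinuousOn z (Set.Icc 0 1))
    (hz : ∀ t ∈ Set.Icc (0 : ℝ) 1, HasRSIntegral (fun s => G (z s)) x 0 t (z t - z 0)) :
    ∃ C, 0 ≤ C ∧ IsDriven G x z C := by
  obtain ⟨B, hB⟩ := isCompact_Icc.exists_bound_of_continuousOn hzc
  have hB0 : 0 ≤ B := (norm_nonneg _).trans (hB 0 (by simp))
  have hM : ∀ t ∈ Set.Icc (0 : ℝ) 1, ‖G (z t)‖ ≤ l * B + b := fun t ht =>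
    (hGb _).trans (by have := hB t ht; gcongr)
  have hM0 : 0 ≤ l * B + b := by positivity
  -- A bootstrap in two rounds: comparing with the zero matrix shows that `z` is Lipschitz;
  -- comparing then with `G (z s)`, whose oscillation is now linear in `t - s`, gives the quadratic
  -- error.
  have hlip : ∀ s t, 0 ≤ s → s ≤ t → t ≤ 1 → ‖z t - z s‖ ≤ (l * B + b) * (L * (t - s)) := by
    intro s t hs hst ht
    have := norm_sub_le_of_hasRSIntegral hx hs hst ht (hz s ⟨hs, hst.trans ht⟩)
      (hz t ⟨hs.trans hst, ht⟩) 0 (ω := l * B + b) (fun u hu => by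
        rw [sub_zero]; exact hM u ⟨hs.trans hu.1, hu.2.trans ht⟩)
    simpa [mulV] using this
  refine ⟨l * ((l * B + b) * L) * L, by positivity, fun s t hs hst ht => ?_⟩
  have h := norm_sub_le_of_hasRSIntegral hx hs hst ht (hz s ⟨hs, hst.trans ht⟩)
    (hz t ⟨hs.trans hst, ht⟩) (G (z s)) (ω := l * ((l * B + b) * (L * (t - s)))) (fun u hu => by
      refine (hG _ _).trans ?_
      have h1 := hlip s u hs hu.1 (hu.2.trans ht)
      have h2 := hu.2
      refine mul_le_mul_of_nonneg_left (h1.trans ?_) hl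
      gcongr)
  rw [sub_sub_sub_cancel_right] at h
  refine h.trans (le_of_eq ?_)
  ring

/-- Quadratic local errors give solutions in the Riemann-Stieltjes sense. -/
theorem IsDriven.hasRSIntegral (hx : LipschitzOnWith L x (Set.Icc 0 1)) (hl : 0 ≤ l)
    (hG : ∀ u u', ‖G u - G u'‖ ≤ l * ‖u - u'‖) (hC : 0 ≤ C) {C' : ℝ} (hC' : 0 ≤ C')
    (hz : IsDriven G x z C) (hlip : ∀ s t, 0 ≤ s → s ≤ t → t ≤ 1 → ‖z t - z s‖ ≤ C' * (t - s))
    {t : ℝ} (ht : t ∈ Set.Icc (0 : ℝ) 1) :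
    HasRSIntegral (fun s => G (z s)) x 0 t (z t - z 0) := by
  intro ε hε
  set D := C + l * C' * L with hD
  have hD0 : 0 ≤ D := by positivity
  -- The `+ 1` keeps the mesh well defined when `D = 0` and makes the final inequality strict.
  refine ⟨ε / (D + 1), by positivity, fun N u ξ humono hu0 huN hξ hmesh => ?_⟩
  have hbd : ∀ k ≤ N, 0 ≤ u k ∧ u k ≤ 1 := fun k hk =>
    ⟨hu0 ▸ humono k.zero_le, (huN ▸ humono hk).trans ht.2⟩
  have hstep : ∀ k ∈ Finset.range N,
      ‖mulV (G (z (ξ k))) (x (u (k + 1)) - x (u k)) - (z (u (k + 1)) - z (u k))‖ ≤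
        D * (ε / (D + 1)) * (u (k + 1) - u k) := by
    intro k hk
    have hk := Finset.mem_range.1 hk
    obtain ⟨a1, -⟩ := hbd k hk.le
    obtain ⟨-, a2⟩ := hbd (k + 1) hk
    have a3 := humono k.le_succ
    simp only [Nat.succ_eq_add_one] at a3
    have a4 : 0 ≤ u (k + 1) - u k := sub_nonneg.2 a3
    obtain ⟨a5, a6⟩ := hξ k hk
    have b1 := hz _ _ a1 a3 a2
    have b2 := norm_sub_le_of_lipschitzOnWith hx a1 a3 a2
    have b3 : ‖z (ξ k) - z (u k)‖ ≤ C' * (u (k + 1) - u k) :=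
      (hlip _ _ a1 a5 (a6.trans a2)).trans (by gcongr)
    have b4 : ‖mulV (G (z (ξ k)) - G (z (u k))) (x (u (k + 1)) - x (u k))‖ ≤
        (l * (C' * (u (k + 1) - u k))) * (L * (u (k + 1) - u k)) :=
      (norm_mulV_le _ _).trans (mul_le_mul ((hG _ _).trans (by gcongr)) b2 (norm_nonneg _)
        (by positivity))
    have e : mulV (G (z (ξ k))) (x (u (k + 1)) - x (u k)) - (z (u (k + 1)) - z (u k)) =
        mulV (G (z (ξ k)) - G (z (u k))) (x (u (k + 1)) - x (u k)) -
          (z (u (k + 1)) - z (u k) - mulV (G (z (u k))) (x (u (k + 1)) - x (u k))) := by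
      rw [sub_mulV]; abel
    rw [e]
    refine (norm_sub_le _ _).trans ?_
    calc _ ≤ (l * (C' * (u (k + 1) - u k))) * (L * (u (k + 1) - u k)) +
          C * (u (k + 1) - u k) ^ 2 := add_le_add b4 b1
      _ = D * (u (k + 1) - u k) * (u (k + 1) - u k) := by rw [hD]; ring
      _ ≤ _ := by
        have := (hmesh k hk).le
        gcongr
  have hsum : z t - z 0 = ∑ k ∈ Finset.range N, (z (u (k + 1)) - z (u k)) := by
    rw [Finset.sum_range_sub (fun k => z (u k)), hu0, huN]
  rw [hsum, ← Finset.sum_sub_distrib]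
  calc _ ≤ ∑ k ∈ Finset.range N, D * (ε / (D + 1)) * (u (k + 1) - u k) :=
        (norm_sum_le _ _).trans (Finset.sum_le_sum hstep)
    _ = D * (ε / (D + 1)) * t := by
        rw [← Finset.mul_sum, Finset.sum_range_sub, hu0, huN, sub_zero]
    _ ≤ D * (ε / (D + 1)) * 1 := by
        have := ht.2
        gcongr
    _ < ε := by
        rw [mul_one, mul_div_assoc', div_lt_iff₀ (by positivity)]
        nlinarith

end CDE

/-! ### Existence of solutions by dyadic Euler schemes -/

section Existence

attribute [local instance] Matrix.frobeniusNormedAddCommGroup Matrix.frobeniusNormedSpace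

open Filter Topology

variable {d p : ℕ} {G : EuclideanSpace ℝ (Fin p) → Matrix (Fin p) (Fin d) ℝ}
  {x : ℝ → EuclideanSpace ℝ (Fin d)} {z₀ : EuclideanSpace ℝ (Fin p)}
  {L : ℝ≥0} {l b : ℝ}

/-- Euler scheme for `dz = G(z) dx` on the dyadic grid of step `2⁻ⁿ`. -/
noncomputable def dyadicEuler (G : EuclideanSpace ℝ (Fin p) → Matrix (Fin p) (Fin d) ℝ)
    (x : ℝ → EuclideanSpace ℝ (Fin d)) (z₀ : EuclideanSpace ℝ (Fin p)) (n : ℕ) :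
    ℕ → EuclideanSpace ℝ (Fin p)
  | 0 => z₀
  | k + 1 => dyadicEuler G x z₀ n k + mulV (G (dyadicEuler G x z₀ n k))
      (x (((k + 1 : ℕ) : ℝ) / 2 ^ n) - x ((k : ℝ) / 2 ^ n))

theorem monotone_dyadic (n : ℕ) : Monotone fun k : ℕ => (k : ℝ) / 2 ^ n := fun a b hab => by
  have : (a : ℝ) ≤ b := by exact_mod_cast hab
  simp only
  gcongr

theorem norm_dyadic_increment_le (hx : LipschitzOnWith L x (Set.Icc 0 1)) (n : ℕ) :
    ∀ k < 2 ^ n, ‖x (((k + 1 : ℕ) : ℝ) / 2 ^ n) - x ((k : ℝ) / 2 ^ n)‖ ≤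
      L * (((k + 1 : ℕ) : ℝ) / 2 ^ n - (k : ℝ) / 2 ^ n) := fun k hk =>
  norm_sub_le_of_lipschitzOnWith hx (by positivity) (monotone_dyadic n k.le_succ) (by
    rw [div_le_one (by positivity)]
    exact_mod_cast hk)

theorem norm_dyadicEuler_le (hx : LipschitzOnWith L x (Set.Icc 0 1)) (hl : 0 ≤ l) (hb : 0 ≤ b)
    (hGb : ∀ u, ‖G u‖ ≤ l * ‖u‖ + b) {n k : ℕ} (hk : k ≤ 2 ^ n) :
    ‖dyadicEuler G x z₀ n k‖ ≤ (‖z₀‖ + b * L) * Real.exp (l * L) := by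
  have h := norm_euler_le (z := dyadicEuler G x z₀ n) (y := fun k => x ((k : ℝ) / 2 ^ n)) hl hb
    L.2 hGb (monotone_dyadic n) (norm_dyadic_increment_le hx n) (fun k _ => rfl) hk
  have h2 := prod_one_add_le_exp_mul hl L.2 (monotone_dyadic n) (2 ^ n)
  have e : (((2 ^ n : ℕ) : ℝ) / 2 ^ n - ((0 : ℕ) : ℝ) / 2 ^ n) = 1 := by simp
  rw [e, mul_one] at h h2
  exact h.trans (mul_le_mul_of_nonneg_left h2 (by have := L.2; positivity))

theorem dyadicEuler_local (hx : LipschitzOnWith L x (Set.Icc 0 1)) (hl : 0 ≤ l) (hb : 0 ≤ b)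
    (hG : ∀ u u', ‖G u - G u'‖ ≤ l * ‖u - u'‖) (hGb : ∀ u, ‖G u‖ ≤ l * ‖u‖ + b) {M : ℝ}
    (hM : M = l * ((‖z₀‖ + b * L) * Real.exp (l * L)) + b) {n k m : ℕ} (hkm : k ≤ m)
    (hm : m ≤ 2 ^ n) :
    ‖dyadicEuler G x z₀ n m - dyadicEuler G x z₀ n k‖ ≤
        M * L * ((m : ℝ) / 2 ^ n - (k : ℝ) / 2 ^ n) ∧
      ‖dyadicEuler G x z₀ n m - dyadicEuler G x z₀ n k - mulV (G (dyadicEuler G x z₀ n k))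
        (x ((m : ℝ) / 2 ^ n) - x ((k : ℝ) / 2 ^ n))‖ ≤
        l * M * L ^ 2 * ((m : ℝ) / 2 ^ n - (k : ℝ) / 2 ^ n) ^ 2 :=
  norm_euler_local_le (z := dyadicEuler G x z₀ n) (y := fun k => x ((k : ℝ) / 2 ^ n)) hl L.2
    (by rw [hM]; positivity) hG (monotone_dyadic n) (norm_dyadic_increment_le hx n)
    (fun k _ => rfl) (fun k hk => (hGb _).trans (by
      rw [hM]
      have := norm_dyadicEuler_le (z₀ := z₀) hx hl hb hGb hk
      gcongr)) hkm hm

/-- Two fine steps agree with one coarse step from the same state up to `O(4⁻ⁿ)`, by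
`dyadicEuler_local`. Grönwall over at most `2 ^ n` coarse steps leaves `O(2⁻ⁿ)`, which is summable
in `n`. -/
theorem norm_dyadicEuler_sub_refine_le (hx : LipschitzOnWith L x (Set.Icc 0 1)) (hl : 0 ≤ l)
    (hb : 0 ≤ b) (hG : ∀ u u', ‖G u - G u'‖ ≤ l * ‖u - u'‖) (hGb : ∀ u, ‖G u‖ ≤ l * ‖u‖ + b)
    {M : ℝ} (hM : M = l * ((‖z₀‖ + b * L) * Real.exp (l * L)) + b) {n k : ℕ} (hk : k ≤ 2 ^ n) :
    ‖dyadicEuler G x z₀ n k - dyadicEuler G x z₀ (n + 1) (2 * k)‖ ≤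
      l * M * L ^ 2 * Real.exp (l * L) / 2 ^ n := by
  have hM0 : 0 ≤ M := by rw [hM]; positivity
  set e := dyadicEuler G x z₀ n with he
  set f := dyadicEuler G x z₀ (n + 1) with hf
  have hcast : ∀ j : ℕ, ((2 * j : ℕ) : ℝ) / 2 ^ (n + 1) = (j : ℝ) / 2 ^ n := fun j => by
    push_cast
    rw [pow_succ]
    field_simp
  have hrec := discrete_gronwall (a := fun k => ‖e k - f (2 * k)‖) (K := 2 ^ n)
    (u := fun _ => l * L * (1 / 2 ^ n)) (w := fun _ => l * M * L ^ 2 * (1 / 2 ^ n) ^ 2)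
    (fun _ => by positivity) (fun _ => by positivity) (fun k hk => by
      have h1 := (dyadicEuler_local (z₀ := z₀) hx hl hb hG hGb hM (n := n + 1)
        (k := 2 * k) (m := 2 * (k + 1)) (by omega) (by rw [pow_succ]; omega)).2
      rw [hcast, hcast, ← hf] at h1
      have hstep : ((k + 1 : ℕ) : ℝ) / 2 ^ n - (k : ℝ) / 2 ^ n = 1 / 2 ^ n := by
        push_cast; ring
      have h2 := norm_dyadic_increment_le hx n k hk
      rw [hstep] at h1 h2
      set Δ := x (((k + 1 : ℕ) : ℝ) / 2 ^ n) - x ((k : ℝ) / 2 ^ n) with hΔ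
      have h3 : e (k + 1) = e k + mulV (G (e k)) Δ := rfl
      have h4 : e (k + 1) - f (2 * (k + 1)) = (e k - f (2 * k)) + mulV (G (e k) - G (f (2 * k))) Δ -
          (f (2 * (k + 1)) - f (2 * k) - mulV (G (f (2 * k))) Δ) := by
        rw [h3, sub_mulV]; abel
      have h5 : ‖mulV (G (e k) - G (f (2 * k))) Δ‖ ≤ l * ‖e k - f (2 * k)‖ * (L * (1 / 2 ^ n)) :=
        (norm_mulV_le _ _).trans (mul_le_mul (hG _ _) h2 (norm_nonneg _) (by positivity))
      have h6 := norm_sub_le ((e k - f (2 * k)) + mulV (G (e k) - G (f (2 * k))) Δ)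
        (f (2 * (k + 1)) - f (2 * k) - mulV (G (f (2 * k))) Δ)
      have h7 := norm_add_le (e k - f (2 * k)) (mulV (G (e k) - G (f (2 * k))) Δ)
      rw [← h4] at h6
      linarith) k hk
  have h0 : e 0 - f (2 * 0) = 0 := sub_self z₀
  rw [h0, norm_zero, zero_add] at hrec
  have hkn : (k : ℝ) * (1 / 2 ^ n) ≤ 1 := by
    rw [mul_one_div, div_le_one (by positivity)]
    exact_mod_cast hk
  have h2 : ∏ _j ∈ Finset.range k, (1 + l * L * (1 / 2 ^ n)) ≤ Real.exp (l * L) := by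
    refine (prod_one_add_le_exp (u := fun _ => l * L * (1 / 2 ^ n)) (fun _ => by positivity) k).trans
      (Real.exp_le_exp.2 ?_)
    rw [Finset.sum_const, Finset.card_range, nsmul_eq_mul]
    have h3 : 0 ≤ l * L := by positivity
    nlinarith
  have h3 : ∑ _j ∈ Finset.range k, l * M * L ^ 2 * (1 / 2 ^ n) ^ 2 ≤
      l * M * L ^ 2 * (1 / 2 ^ n) := by
    rw [Finset.sum_const, Finset.card_range, nsmul_eq_mul]
    have h4 : (0 : ℝ) ≤ l * M * L ^ 2 * (1 / 2 ^ n) := by positivity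
    nlinarith
  calc _ ≤ _ := hrec
    _ ≤ l * M * L ^ 2 * (1 / 2 ^ n) * Real.exp (l * L) :=
      mul_le_mul h3 h2 (Finset.prod_nonneg fun _ _ => by positivity) (by positivity)
    _ = _ := by ring

theorem floor_dyadic_le {t : ℝ} (ht1 : t ≤ 1) (n : ℕ) : ⌊t * 2 ^ n⌋₊ ≤ 2 ^ n := by
  refine Nat.floor_le_of_le ?_
  push_cast
  exact mul_le_of_le_one_left (by positivity) ht1

theorem tendsto_floor_dyadic {t : ℝ} (ht0 : 0 ≤ t) :
    Tendsto (fun n : ℕ => (⌊t * 2 ^ n⌋₊ : ℝ) / 2 ^ n) atTop (𝓝 t) :=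
  (tendsto_nat_floor_mul_div_atTop ht0).comp
    (tendsto_pow_atTop_atTop_of_one_lt (one_lt_two : (1 : ℝ) < 2))

/-- The dyadic Euler schemes converge, to a path driven by `G(z) dx`. -/
theorem exists_isDriven (hx : LipschitzOnWith L x (Set.Icc 0 1)) (hl : 0 ≤ l)
    (hb : 0 ≤ b) (hG : ∀ u u', ‖G u - G u'‖ ≤ l * ‖u - u'‖) (hGb : ∀ u, ‖G u‖ ≤ l * ‖u‖ + b)
    (z₀ : EuclideanSpace ℝ (Fin p)) :
    ∃ (z : ℝ → EuclideanSpace ℝ (Fin p)) (C C' : ℝ), z 0 = z₀ ∧ 0 ≤ C ∧ 0 ≤ C' ∧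
      IsDriven G x z C ∧ (∀ s t, 0 ≤ s → s ≤ t → t ≤ 1 → ‖z t - z s‖ ≤ C' * (t - s)) ∧
      Tendsto (fun n => dyadicEuler G x z₀ n (2 ^ n)) atTop (𝓝 (z 1)) := by
  obtain ⟨M, hM⟩ : ∃ M, M = l * ((‖z₀‖ + b * L) * Real.exp (l * L)) + b := ⟨_, rfl⟩
  have hM0 : 0 ≤ M := by rw [hM]; positivity
  have hcauchy : ∀ t ∈ Set.Icc (0 : ℝ) 1,
      CauchySeq fun n => dyadicEuler G x z₀ n ⌊t * 2 ^ n⌋₊ := by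
    rintro t ⟨ht0, ht1⟩
    refine cauchySeq_of_le_geometric (1 / 2) (l * M * L ^ 2 * Real.exp (l * L) + M * L)
      (by norm_num) fun n => ?_
    rw [dist_eq_norm]
    -- The index of `t` on the fine grid is `2 k` or `2 k + 1`, with `k` its index on the coarse
    -- grid. Consecutive schemes thus differ by a refinement error and at most one fine step, both
    -- of order `2⁻ⁿ`.
    have hdiv : ⌊t * 2 ^ (n + 1)⌋₊ / 2 = ⌊t * 2 ^ n⌋₊ := by
      have h := Nat.floor_div_natCast (t * 2 ^ (n + 1)) 2
      rw [← h]
      congr 1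
      rw [pow_succ]
      push_cast
      field_simp
    set k := ⌊t * 2 ^ n⌋₊ with hk
    set m := ⌊t * 2 ^ (n + 1)⌋₊ with hm
    have hk1 : k ≤ 2 ^ n := floor_dyadic_le ht1 n
    have hm1 : m ≤ 2 ^ (n + 1) := floor_dyadic_le ht1 (n + 1)
    have h1 := norm_dyadicEuler_sub_refine_le (z₀ := z₀) hx hl hb hG hGb hM hk1
    have h2 := (dyadicEuler_local (z₀ := z₀) hx hl hb hG hGb hM (n := n + 1)
      (k := 2 * k) (m := m) (by omega) hm1).1
    have h3 : (m : ℝ) / 2 ^ (n + 1) - ((2 * k : ℕ) : ℝ) / 2 ^ (n + 1) ≤ 1 / 2 ^ n := by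
      have h4 : (m : ℝ) ≤ (2 * k : ℕ) + 1 := by
        have : m ≤ 2 * k + 1 := by omega
        exact_mod_cast this
      rw [← sub_div, pow_succ, div_le_div_iff₀ (by positivity) (by positivity)]
      have h5 : (0 : ℝ) < 2 ^ n := by positivity
      nlinarith
    have h4 := h2.trans (mul_le_mul_of_nonneg_left h3 (by positivity : 0 ≤ M * (L : ℝ)))
    have h5 := norm_sub_le_norm_sub_add_norm_sub (dyadicEuler G x z₀ n k)
      (dyadicEuler G x z₀ (n + 1) (2 * k)) (dyadicEuler G x z₀ (n + 1) m)
    rw [norm_sub_rev] at h4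
    refine h5.trans ((add_le_add h1 h4).trans (le_of_eq ?_))
    rw [one_div_pow]
    ring
  have hlim : ∀ t, ∃ y, t ∈ Set.Icc (0 : ℝ) 1 →
      Tendsto (fun n => dyadicEuler G x z₀ n ⌊t * 2 ^ n⌋₊) atTop (𝓝 y) := by
    intro t
    by_cases ht : t ∈ Set.Icc (0 : ℝ) 1
    · obtain ⟨y, hy⟩ := cauchySeq_tendsto_of_complete (hcauchy t ht)
      exact ⟨y, fun _ => hy⟩
    · exact ⟨0, fun h => absurd h ht⟩
  choose z hz using hlim
  have hxlim : ∀ t ∈ Set.Icc (0 : ℝ) 1,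
      Tendsto (fun n : ℕ => x ((⌊t * 2 ^ n⌋₊ : ℝ) / 2 ^ n)) atTop (𝓝 (x t)) := by
    intro t ht
    refine (hx.continuousOn t ht).tendsto.comp (tendsto_nhdsWithin_iff.2
      ⟨tendsto_floor_dyadic ht.1, Eventually.of_forall fun n => ⟨by positivity, ?_⟩⟩)
    rw [div_le_one (by positivity)]
    exact_mod_cast floor_dyadic_le ht.2 n
  have hGc : Continuous G := by
    refine (LipschitzWith.of_dist_le_mul (K := ⟨l, hl⟩) fun u v => ?_).continuous
    rw [dist_eq_norm, dist_eq_norm]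
    exact hG u v
  refine ⟨z, l * M * L ^ 2, M * L, ?_, by positivity, by positivity, ?_, ?_, ?_⟩
  · have h := hz 0 (by simp)
    simp only [zero_mul, Nat.floor_zero] at h
    exact tendsto_nhds_unique h tendsto_const_nhds
  · intro s t hs hst ht
    have hsI : s ∈ Set.Icc (0 : ℝ) 1 := ⟨hs, hst.trans ht⟩
    have htI : t ∈ Set.Icc (0 : ℝ) 1 := ⟨hs.trans hst, ht⟩
    have hmul : Tendsto (fun n : ℕ => mulV (G (dyadicEuler G x z₀ n ⌊s * 2 ^ n⌋₊))
        (x ((⌊t * 2 ^ n⌋₊ : ℝ) / 2 ^ n) - x ((⌊s * 2 ^ n⌋₊ : ℝ) / 2 ^ n))) atTop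
        (𝓝 (mulV (G (z s)) (x t - x s))) :=
      (isBoundedBilinearMap_mulV.continuous.tendsto (G (z s), x t - x s)).comp
        (((hGc.tendsto _).comp (hz s hsI)).prodMk_nhds ((hxlim t htI).sub (hxlim s hsI)))
    refine le_of_tendsto_of_tendsto' (((hz t htI).sub (hz s hsI)).sub hmul).norm
      ((((tendsto_floor_dyadic htI.1).sub (tendsto_floor_dyadic hs)).pow 2).const_mul _)
      fun n => ?_
    exact (dyadicEuler_local hx hl hb hG hGb hM (Nat.floor_le_floor (by gcongr))
      (floor_dyadic_le ht n)).2
  · intro s t hs hst ht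
    have hsI : s ∈ Set.Icc (0 : ℝ) 1 := ⟨hs, hst.trans ht⟩
    have htI : t ∈ Set.Icc (0 : ℝ) 1 := ⟨hs.trans hst, ht⟩
    refine le_of_tendsto_of_tendsto' ((hz t htI).sub (hz s hsI)).norm
      (((tendsto_floor_dyadic htI.1).sub (tendsto_floor_dyadic hs)).const_mul _) fun n => ?_
    exact (dyadicEuler_local hx hl hb hG hGb hM (Nat.floor_le_floor (by gcongr))
      (floor_dyadic_le ht n)).1
  · have h := hz 1 (by simp)
    have e : ∀ n : ℕ, ⌊(1 : ℝ) * 2 ^ n⌋₊ = 2 ^ n := fun n => by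
      rw [one_mul]
      exact_mod_cast Nat.floor_natCast (R := ℝ) (2 ^ n)
    simpa only [e] using h

end Existence

/-! ### A priori bounds and stability of the latent states -/

section States

attribute [local instance] Matrix.frobeniusNormedAddCommGroup Matrix.frobeniusNormedSpace

open Filter Topology

variable {d p q K : ℕ} {c : Bounds} {σ : ℝ → ℝ}

theorem Bounds.lipField_nonneg (c : Bounds) (q : ℕ) : 0 ≤ c.lipField q := by
  unfold Bounds.lipField; positivity

theorem Bounds.κ_nonneg (c : Bounds) (q : ℕ) : 0 ≤ c.κ q := c.β_nonneg q

theorem Bounds.radius_nonneg (c : Bounds) (q : ℕ) : 0 ≤ c.radius q := by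
  have := c.κ_nonneg q
  unfold Bounds.radius
  positivity

theorem Grid.mesh_nonneg (D : Grid K) : 0 ≤ D.mesh :=
  Real.iSup_nonneg fun k => sub_nonneg.2 (D.strictMono k.castSucc_lt_succ).le

theorem Bounds.radiusD_nonneg (c : Bounds) (q : ℕ) (D : Grid K) : 0 ≤ c.radiusD q D := by
  have := c.κ_nonneg q
  have := D.mesh_nonneg
  have := c.lipField_nonneg q
  unfold Bounds.radiusD
  positivity

/-- Every set of parameters satisfies some bounds. -/
theorem exists_bounds_mem_paramSet (θ : Params d p q) (L : ℝ≥0) :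
    ∃ c : Bounds, c.Lσ = L ∧ θ ∈ paramSet d p q c := by
  refine ⟨⟨‖θ.readout‖₊, ∑ h, ‖θ.A h‖₊ + ‖θ.Alast‖₊, ∑ h, ‖θ.b h‖₊ + ‖θ.blast‖₊, ‖θ.U‖₊, ‖θ.v‖₊, 0,
    L, 0⟩, rfl, le_rfl, fun h => ?_, fun h => ?_, ?_, ?_, le_rfl, le_rfl⟩
  · rw [← coe_nnnorm, NNReal.coe_le_coe]
    exact le_add_right (Finset.single_le_sum (f := fun h => ‖θ.A h‖₊) (fun _ _ => zero_le)
      (Finset.mem_univ h))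
  · rw [← coe_nnnorm, NNReal.coe_le_coe]
    exact le_add_right (Finset.single_le_sum (f := fun h => ‖θ.b h‖₊) (fun _ _ => zero_le)
      (Finset.mem_univ h))
  · rw [← coe_nnnorm, NNReal.coe_le_coe]
    exact le_add_left le_rfl
  · rw [← coe_nnnorm, NNReal.coe_le_coe]
    exact le_add_left le_rfl

theorem norm_field_sub_self_le (hq : 1 ≤ q) (hσ : LipschitzWith c.Lσ σ) (hσ0 : σ 0 = 0)
    {θ : Params d p q} (hθ : θ ∈ paramSet d p q c) (u u' : EuclideanSpace ℝ (Fin p)) :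
    ‖θ.field σ u - θ.field σ u'‖ ≤ c.lipField q * ‖u - u'‖ := by
  simpa [fieldGap_self] using norm_field_sub_le hq hσ hσ0 hθ hθ u u'

/-! ### Homogeneous controlled ResNets -/

/-- The ResNet states on a sampled path form an Euler scheme. -/
theorem exists_euler_of_seriesInput (D : Grid K) (y : SeriesInput d c D) :
    ∃ (t : ℕ → ℝ) (x : ℕ → EuclideanSpace ℝ (Fin d)), Monotone t ∧ t 0 = 0 ∧ t K = 1 ∧
      (∀ k, t (k + 1) - t k ≤ D.mesh) ∧ ‖y.1 0‖ ≤ c.Bx ∧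
      (∀ k < K, ‖x (k + 1) - x k‖ ≤ c.Lx * (t (k + 1) - t k)) ∧
      ∀ θ : Params d p q, ∃ z : ℕ → EuclideanSpace ℝ (Fin p), z 0 = θ.init σ (y.1 0) ∧
        (∀ k < K, z (k + 1) = z k + mulV (θ.field σ (z k)) (x (k + 1) - x k)) ∧
        z K = θ.resNetState σ y.1 := by
  obtain ⟨y, ⟨x, hx, hx0⟩, hy⟩ := y
  -- Indices are clamped at `K`, so that times and samples become sequences on `ℕ`, constant after
  -- `K`, with times monotone everywhere.
  let i : ℕ → Fin (K + 1) := fun k => ⟨min k K, by omega⟩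
  have hi0 : i 0 = 0 := Fin.ext (by simp [i])
  have hiK : i K = Fin.last K := Fin.ext (by simp [i])
  have hi1 : ∀ k (h : k < K), i (k + 1) = (⟨k, h⟩ : Fin K).succ := fun k h =>
    Fin.ext (by simp [i]; omega)
  have hi2 : ∀ k (h : k < K), i k = (⟨k, h⟩ : Fin K).castSucc := fun k h =>
    Fin.ext (by simp [i]; omega)
  have hi3 : ∀ k, K ≤ k → i k = Fin.last K := fun k h => Fin.ext (by simp [i]; omega)
  have himono : Monotone i := fun a b hab => Fin.le_def.2 (min_le_min_right K hab)
  have htmono : Monotone fun k => D.t (i k) := D.strictMono.monotone.comp himono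
  refine ⟨fun k => D.t (i k), fun k => y (i k), htmono, by simp only [hi0, D.zero],
    by simp only [hiK, D.one], fun k => ?_, ?_, fun k hk => ?_, fun θ => ?_⟩
  · rcases lt_or_ge k K with h | h
    · simp only [hi1 k h, hi2 k h]
      exact le_ciSup (f := fun k : Fin K => D.t k.succ - D.t k.castSucc)
        (Set.finite_range _).bddAbove ⟨k, h⟩
    · simp only [hi3 k h, hi3 (k + 1) (by omega), sub_self]
      exact D.mesh_nonneg
  · change ‖y 0‖ ≤ _
    rw [hy, D.zero]
    exact hx0
  · simp only [hy]
    refine norm_sub_le_of_lipschitzOnWith hx ?_ (htmono k.le_succ) ?_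
    · rw [← D.zero]
      exact D.strictMono.monotone (Fin.zero_le _)
    · rw [← D.one]
      exact D.strictMono.monotone (Fin.le_last _)
  · obtain ⟨z, h0, h1, h2⟩ := foldl_eq_sequence
      (fun z (k : Fin K) => z + mulV (θ.field σ z) (y k.succ - y k.castSucc)) (θ.init σ (y 0))
    refine ⟨z, h0, fun k hk => ?_, h2⟩
    simp only [hi1 k hk, hi2 k hk]
    exact h1 k hk

theorem prod_mesh_le (c : Bounds) (q : ℕ) (D : Grid K) {t : ℕ → ℝ} (ht : Monotone t)
    (hmesh : ∀ k, t (k + 1) - t k ≤ D.mesh) :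
    ∏ j ∈ Finset.range K, (1 + c.lipField q * c.Lx * (t (j + 1) - t j)) ≤
      (1 + c.lipField q * c.Lx * D.mesh) ^ K := by
  have hl := c.lipField_nonneg q
  calc _ ≤ ∏ _j ∈ Finset.range K, (1 + c.lipField q * c.Lx * D.mesh) := by
        refine Finset.prod_le_prod (fun j _ => ?_) fun j _ => ?_
        · have := sub_nonneg.2 (ht j.le_succ)
          positivity
        · have := hmesh j
          gcongr
    _ = _ := by simp

theorem norm_resNetState_le (hq : 1 ≤ q) (hσ : LipschitzWith c.Lσ σ) (hσ0 : σ 0 = 0) (D : Grid K)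
    {θ : Params d p q} (hθ : θ ∈ paramSet d p q c) (y : SeriesInput d c D) :
    ‖θ.resNetState σ y.1‖ ≤ c.radiusD q D := by
  obtain ⟨t, x, ht, ht0, htK, hmesh, hy0, hx, hz⟩ :=
    exists_euler_of_seriesInput (p := p) (q := q) (σ := σ) D y
  obtain ⟨z, hz0, hz1, hzK⟩ := hz θ
  have hl := c.lipField_nonneg q
  have hκ := c.κ_nonneg q
  have h := norm_euler_le hl hκ c.Lx.2 (norm_field_le hq hσ hσ0 hθ) ht hx hz1 le_rfl
  rw [hzK, hz0, ht0, htK, sub_zero, mul_one] at h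
  refine h.trans ?_
  have h1 := prod_mesh_le c q D ht hmesh
  have h2 := norm_init_le hσ hσ0 hθ hy0
  have h3 : 0 ≤ ‖θ.init σ (y.1 0)‖ + c.κ q * c.Lx := by positivity
  exact (mul_le_mul_of_nonneg_left h1 h3).trans
    (mul_le_mul_of_nonneg_right (by gcongr) (by have := D.mesh_nonneg; positivity))

/-- Only the radius depends on the grid: the stability factor is bounded by the exponential, because
the gaps sum to 1. -/
theorem norm_resNetState_sub_le (hq : 1 ≤ q) (hσ : LipschitzWith c.Lσ σ) (hσ0 : σ 0 = 0)
    (D : Grid K) {θ θ' : Params d p q} (hθ : θ ∈ paramSet d p q c) (hθ' : θ' ∈ paramSet d p q c)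
    (y : SeriesInput d c D) :
    ‖θ.resNetState σ y.1 - θ'.resNetState σ y.1‖ ≤
      (c.Lσ * (‖θ.U - θ'.U‖ * c.Bx + ‖θ.v - θ'.v‖) + c.fieldGap θ θ' (c.radiusD q D) * c.Lx) *
        Real.exp (c.lipField q * c.Lx) := by
  obtain ⟨t, x, ht, ht0, htK, hmesh, hy0, hx, hz⟩ :=
    exists_euler_of_seriesInput (p := p) (q := q) (σ := σ) D y
  obtain ⟨z, hz0, hz1, hzK⟩ := hz θ
  obtain ⟨z', hz0', hz1', hzK'⟩ := hz θ'
  have hl := c.lipField_nonneg q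
  have hκ := c.κ_nonneg q
  have hR := c.radiusD_nonneg q D
  have hρ : ∀ k ≤ K, ‖z k‖ ≤ c.radiusD q D := fun k hk => by
    have h := norm_euler_le hl hκ c.Lx.2 (norm_field_le hq hσ hσ0 hθ) ht hx hz1 hk
    rw [hz0, ht0, htK, sub_zero, mul_one] at h
    refine h.trans ?_
    have h1 := prod_mesh_le c q D ht hmesh
    have h2 := norm_init_le hσ hσ0 hθ hy0
    have h3 : 0 ≤ ‖θ.init σ (y.1 0)‖ + c.κ q * c.Lx := by positivity
    exact (mul_le_mul_of_nonneg_left h1 h3).trans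
      (mul_le_mul_of_nonneg_right (by gcongr) (by have := D.mesh_nonneg; positivity))
  have h := norm_euler_sub_le hl c.Lx.2 (fieldGap_nonneg θ θ' hR)
    (fun u u' hu => (norm_field_sub_le hq hσ hσ0 hθ hθ' u u').trans
      (by have := fieldGap_mono (c := c) θ θ' hu; gcongr)) ht hx hz1 hz1' hρ
  rw [hzK, hzK', hz0, hz0', ht0, htK, sub_zero, mul_one, mul_one] at h
  refine h.trans (mul_le_mul_of_nonneg_right ?_ (Real.exp_pos _).le)
  exact add_le_add (norm_init_sub_le hσ θ θ' hy0) le_rfl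

/-! ### Neural controlled differential equations -/

/-- The third clause identifies the solution at time 1 as a limit of Euler schemes, through which
all quantitative bounds are transferred. -/
theorem exists_isSolution (hq : 1 ≤ q) {L Lx : ℝ≥0} (hσ : LipschitzWith L σ) (hσ0 : σ 0 = 0)
    (θ : Params d p q) {x : ℝ → EuclideanSpace ℝ (Fin d)}
    (hx : LipschitzOnWith Lx x (Set.Icc 0 1)) :
    ∃ z, θ.IsSolution σ x z ∧ (∀ w, θ.IsSolution σ x w → Set.EqOn w z (Set.Icc 0 1)) ∧
      Tendsto (fun n => dyadicEuler (θ.field σ) x (θ.init σ (x 0)) n (2 ^ n)) atTop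
        (𝓝 (z 1)) := by
  -- Well-posedness is needed for every `θ`, not only in a prescribed `Θ`, so bounds adapted to this
  -- `θ` are introduced.
  obtain ⟨c, rfl, hθ⟩ := exists_bounds_mem_paramSet θ L
  have hl := c.lipField_nonneg q
  have hG := norm_field_sub_self_le hq hσ hσ0 hθ
  have hGb := norm_field_le hq hσ hσ0 hθ
  obtain ⟨z, C, C', h0, hC, hC', hz, hlip, hlim⟩ :=
    exists_isDriven hx hl (c.κ_nonneg q) hG hGb (θ.init σ (x 0))
  refine ⟨z, ⟨?_, h0, fun t ht => hz.hasRSIntegral hx hl hG hC hC' hlip ht⟩, ?_, hlim⟩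
  · refine (LipschitzOnWith.of_dist_le_mul (K := ⟨C', hC'⟩) fun s hs t ht => ?_).continuousOn
    rw [dist_eq_norm, Real.dist_eq]
    rcases le_total s t with h | h
    · rw [norm_sub_rev, abs_sub_comm, abs_of_nonneg (sub_nonneg.2 h)]
      exact hlip s t hs.1 h ht.2
    · rw [abs_of_nonneg (sub_nonneg.2 h)]
      exact hlip t s ht.1 h hs.2
  · rintro w ⟨hwc, hw0, hw⟩
    obtain ⟨C₂, hC₂, hw'⟩ := exists_isDriven_of_hasRSIntegral hx hl (c.κ_nonneg q) hG hGb hwc hw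
    exact hw'.eqOn hx hl hG hC₂ hC hz (hw0.trans h0.symm)

/-- `trajectory` is an arbitrary choice of solution; uniqueness forces its value at time 1 to be the
Euler limit. -/
theorem tendsto_dyadicEuler_trajectory (hq : 1 ≤ q) (hσ : LipschitzWith c.Lσ σ) (hσ0 : σ 0 = 0)
    (θ : Params d p q) (x : PathInput d c) :
    Tendsto (fun n => dyadicEuler (θ.field σ) x.1 (θ.init σ (x.1 0)) n (2 ^ n)) atTop
        (𝓝 (θ.trajectory σ x.1 1)) := by
  obtain ⟨z, hz, huniq, hlim⟩ := exists_isSolution hq hσ hσ0 θ x.2.1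
  have hex : ∃ z, θ.IsSolution σ x.1 z := ⟨z, hz⟩
  have h : θ.trajectory σ x.1 = hex.choose := by
    unfold Params.trajectory
    rw [dif_pos hex]
  rw [h, huniq _ hex.choose_spec (by simp : (1 : ℝ) ∈ Set.Icc (0 : ℝ) 1)]
  exact hlim

theorem norm_dyadicEuler_field_le (hq : 1 ≤ q) (hσ : LipschitzWith c.Lσ σ) (hσ0 : σ 0 = 0)
    {θ : Params d p q} (hθ : θ ∈ paramSet d p q c) (x : PathInput d c) {n k : ℕ}
    (hk : k ≤ 2 ^ n) :
    ‖dyadicEuler (θ.field σ) x.1 (θ.init σ (x.1 0)) n k‖ ≤ c.radius q := by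
  refine (norm_dyadicEuler_le x.2.1 (c.lipField_nonneg q) (c.κ_nonneg q)
    (norm_field_le hq hσ hσ0 hθ) hk).trans ?_
  have := norm_init_le hσ hσ0 hθ x.2.2
  unfold Bounds.radius
  gcongr

theorem norm_trajectory_le (hq : 1 ≤ q) (hσ : LipschitzWith c.Lσ σ) (hσ0 : σ 0 = 0)
    {θ : Params d p q} (hθ : θ ∈ paramSet d p q c) (x : PathInput d c) :
    ‖θ.trajectory σ x.1 1‖ ≤ c.radius q :=
  le_of_tendsto' (tendsto_dyadicEuler_trajectory hq hσ hσ0 θ x).norm fun _ =>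
    norm_dyadicEuler_field_le hq hσ hσ0 hθ x le_rfl

theorem norm_trajectory_sub_le (hq : 1 ≤ q) (hσ : LipschitzWith c.Lσ σ) (hσ0 : σ 0 = 0)
    {θ θ' : Params d p q} (hθ : θ ∈ paramSet d p q c) (hθ' : θ' ∈ paramSet d p q c)
    (x : PathInput d c) :
    ‖θ.trajectory σ x.1 1 - θ'.trajectory σ x.1 1‖ ≤
      (c.Lσ * (‖θ.U - θ'.U‖ * c.Bx + ‖θ.v - θ'.v‖) + c.fieldGap θ θ' (c.radius q) * c.Lx) *
        Real.exp (c.lipField q * c.Lx) := by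
  refine le_of_tendsto' ((tendsto_dyadicEuler_trajectory hq hσ hσ0 θ x).sub
    (tendsto_dyadicEuler_trajectory hq hσ hσ0 θ' x)).norm fun n => ?_
  have h := norm_euler_sub_le (y := fun k => x.1 ((k : ℝ) / 2 ^ n))
    (z := dyadicEuler (θ.field σ) x.1 (θ.init σ (x.1 0)) n)
    (z' := dyadicEuler (θ'.field σ) x.1 (θ'.init σ (x.1 0)) n)
    (c.lipField_nonneg q) c.Lx.2 (fieldGap_nonneg θ θ' (c.radius_nonneg q))
    (fun u u' hu => (norm_field_sub_le hq hσ hσ0 hθ hθ' u u').trans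
      (by have := fieldGap_mono (c := c) θ θ' hu; gcongr)) (monotone_dyadic n)
    (norm_dyadic_increment_le x.2.1 n) (fun _ _ => rfl) (fun _ _ => rfl)
    (fun k hk => norm_dyadicEuler_field_le hq hσ hσ0 hθ x hk)
  have e : (((2 ^ n : ℕ) : ℝ) / 2 ^ n - ((0 : ℕ) : ℝ) / 2 ^ n) = 1 := by simp
  rw [e, mul_one, mul_one] at h
  refine h.trans (mul_le_mul_of_nonneg_right ?_ (Real.exp_pos _).le)
  exact add_le_add (norm_init_sub_le hσ θ θ' x.2.2) le_rfl

end States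

/-! ### Parametric Lipschitz bounds and covers of the predictor class -/

section Covering

attribute [local instance] Matrix.frobeniusNormedAddCommGroup Matrix.frobeniusNormedSpace

variable {d p q : ℕ} {c : Bounds}

/-! ### Lipschitz dependence of the predictors on the parameters -/

namespace Bounds

theorem lipField_term_le_Cb (c : Bounds) (i : Fin q) :
    c.BΦ * c.Lx * Real.exp (c.lipField q * c.Lx) *
      (((c.Lσ : ℝ) * c.BA) ^ (q - 1 - (i : ℕ)) * c.Lσ) ≤ c.Cb q := by
  unfold Cb
  refine mul_le_mul_of_nonneg_left ?_ (by positivity)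
  exact le_ciSup (f := fun i : Fin q => ((c.Lσ : ℝ) * c.BA) ^ (q - 1 - (i : ℕ)) * c.Lσ)
    (Set.finite_range _).bddAbove i

theorem lipField_term_le_CA (c : Bounds) (ρ : ℝ) (i : Fin q) :
    c.BΦ * c.Lx * Real.exp (c.lipField q * c.Lx) *
      (((c.Lσ : ℝ) * c.BA) ^ (q - 1 - (i : ℕ)) * c.Lσ *
        (((c.Lσ : ℝ) * c.BA) ^ (i : ℕ) * ρ + c.β i)) ≤ c.CA q ρ := by
  unfold CA
  refine mul_le_mul_of_nonneg_left ?_ (by positivity)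
  exact le_ciSup (f := fun i : Fin q => ((c.Lσ : ℝ) * c.BA) ^ (q - 1 - (i : ℕ)) * c.Lσ *
    (((c.Lσ : ℝ) * c.BA) ^ (i : ℕ) * ρ + c.β i)) (Set.finite_range _).bddAbove i

theorem Cb_nonneg (c : Bounds) (q : ℕ) : 0 ≤ c.Cb q :=
  mul_nonneg (by positivity) (Real.iSup_nonneg fun _ => by positivity)

theorem CA_nonneg (c : Bounds) (q : ℕ) {ρ : ℝ} (hρ : 0 ≤ ρ) : 0 ≤ c.CA q ρ :=
  mul_nonneg (by positivity) (Real.iSup_nonneg fun i => by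
    have := c.β_nonneg i
    positivity)

theorem CU_nonneg (c : Bounds) (q : ℕ) : 0 ≤ c.CU q := by unfold CU; positivity

theorem Cv_nonneg (c : Bounds) (q : ℕ) : 0 ≤ c.Cv q := by unfold Cv; positivity

/-- The coefficient of each layer is one of the terms in the suprema defining `CA` and `Cb`: index
`h` for the hidden layers and `q - 1` for the last. -/
theorem fieldGap_le (hq : 1 ≤ q) (θ θ' : Params d p q) (ρ : ℝ) :
    c.BΦ * c.Lx * Real.exp (c.lipField q * c.Lx) * c.fieldGap θ θ' ρ ≤
      ∑ h, (c.CA q ρ * ‖θ.A h - θ'.A h‖ + c.Cb q * ‖θ.b h - θ'.b h‖) +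
        (c.CA q ρ * ‖θ.Alast - θ'.Alast‖ + c.Cb q * ‖θ.blast - θ'.blast‖) := by
  set P := c.BΦ * c.Lx * Real.exp (c.lipField q * c.Lx) with hP
  set s := (c.Lσ : ℝ) * c.BA with hs
  have key : ∀ (i : Fin q) (a b : ℝ), 0 ≤ a → 0 ≤ b →
      P * (s ^ (q - 1 - (i : ℕ)) * (c.Lσ * (a * (s ^ (i : ℕ) * ρ + c.β i) + b))) ≤
        c.CA q ρ * a + c.Cb q * b := by
    intro i a b ha hb
    have h1 := mul_le_mul_of_nonneg_right (c.lipField_term_le_CA ρ i) ha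
    have h2 := mul_le_mul_of_nonneg_right (c.lipField_term_le_Cb i) hb
    refine le_trans (le_of_eq ?_) (add_le_add h1 h2)
    rw [← hP, ← hs]
    ring
  unfold fieldGap
  rw [mul_add, Finset.mul_sum]
  refine add_le_add (Finset.sum_le_sum fun h _ => ?_) ?_
  · exact key ⟨h, by have := h.2; omega⟩ _ _ (norm_nonneg _) (norm_nonneg _)
  · have := key ⟨q - 1, by omega⟩ _ _ (norm_nonneg (θ.Alast - θ'.Alast))
      (norm_nonneg (θ.blast - θ'.blast))
    simpa only [Nat.sub_self, pow_zero, one_mul] using this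

end Bounds

/-- States depending on the parameters the way the latent states of a NCDE do: they stay in the
ball of radius `ρ`, and they are Lipschitz in the parameters. -/
structure IsStable {X : Type*} (c : Bounds) (ρ : ℝ)
    (s : Params d p q → X → EuclideanSpace ℝ (Fin p)) : Prop where
  nonneg : 0 ≤ ρ
  norm_le : ∀ θ ∈ paramSet d p q c, ∀ x, ‖s θ x‖ ≤ ρ
  norm_sub_le : ∀ θ ∈ paramSet d p q c, ∀ θ' ∈ paramSet d p q c, ∀ x, ‖s θ x - s θ' x‖ ≤
    (c.Lσ * (‖θ.U - θ'.U‖ * c.Bx + ‖θ.v - θ'.v‖) + c.fieldGap θ θ' ρ * c.Lx) *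
      Real.exp (c.lipField q * c.Lx)

/-- The class of the linear readouts of the states `s`. -/
def readoutClass {X : Type*} (c : Bounds) (s : Params d p q → X → EuclideanSpace ℝ (Fin p)) :
    Set (X → ℝ) :=
  (fun θ x => inner ℝ θ.readout (s θ x)) '' paramSet d p q c

variable {X : Type*} {ρ : ℝ} {s : Params d p q → X → EuclideanSpace ℝ (Fin p)}

theorem IsStable.abs_le (hs : IsStable c ρ s) {f : X → ℝ} (hf : f ∈ readoutClass c s) (x : X) :
    |f x| ≤ c.BΦ * ρ := by
  obtain ⟨θ, hθ, rfl⟩ := hf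
  exact (abs_real_inner_le_norm _ _).trans
    (mul_le_mul hθ.1 (hs.norm_le θ hθ x) (norm_nonneg _) (by positivity))

/-- The difference of inner products splits into a change of readout against a state of norm at most
`ρ`, and a readout of norm at most `BΦ` against a change of state. -/
theorem IsStable.abs_sub_le (hs : IsStable c ρ s) (hq : 1 ≤ q) {θ θ' : Params d p q}
    (hθ : θ ∈ paramSet d p q c) (hθ' : θ' ∈ paramSet d p q c) (x : X) :
    |inner ℝ θ.readout (s θ x) - inner ℝ θ'.readout (s θ' x)| ≤
      ρ * ‖θ.readout - θ'.readout‖ + c.CU q * ‖θ.U - θ'.U‖ + c.Cv q * ‖θ.v - θ'.v‖ +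
        (∑ h, (c.CA q ρ * ‖θ.A h - θ'.A h‖ + c.Cb q * ‖θ.b h - θ'.b h‖) +
          (c.CA q ρ * ‖θ.Alast - θ'.Alast‖ + c.Cb q * ‖θ.blast - θ'.blast‖)) := by
  have e : inner ℝ θ.readout (s θ x) - inner ℝ θ'.readout (s θ' x) =
      inner ℝ (θ.readout - θ'.readout) (s θ x) + inner ℝ θ'.readout (s θ x - s θ' x) := by
    rw [inner_sub_left, inner_sub_right]; ring
  have h1 : |inner ℝ (θ.readout - θ'.readout) (s θ x)| ≤ ‖θ.readout - θ'.readout‖ * ρ :=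
    (abs_real_inner_le_norm _ _).trans
      (mul_le_mul_of_nonneg_left (hs.norm_le θ hθ x) (norm_nonneg _))
  have h2 : |inner ℝ θ'.readout (s θ x - s θ' x)| ≤ c.BΦ * _ :=
    (abs_real_inner_le_norm _ _).trans
      (mul_le_mul hθ'.1 (hs.norm_sub_le θ hθ θ' hθ' x) (norm_nonneg _) (by positivity))
  have h3 := Bounds.fieldGap_le (c := c) hq θ θ' ρ
  rw [e]
  refine (abs_add_le _ _).trans ((add_le_add h1 h2).trans ?_)
  rw [Bounds.CU, Bounds.Cv]
  linarith

/-! ### Covering the parameter set -/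

/-- The tolerance is the share of one block out of `2q + 3`, and `Cq q = 4 (2q + 3)` turns `2 K / (η
/ (2q + 3))` into `Cq q * K / (2 η)`. -/
theorem exists_net_of_mul_le {E : Type*} [NormedAddCommGroup E] [NormedSpace ℝ E]
    [FiniteDimensional ℝ E] {B a K η : ℝ} (hB : 0 ≤ B) (ha : 0 ≤ a) (hη : 0 < η)
    (hK : B * a ≤ K) (q : ℕ) :
    ∃ C : Finset E, (∀ x ∈ C, ‖x‖ ≤ B) ∧
      (∀ x, ‖x‖ ≤ B → ∃ y ∈ C, a * ‖x - y‖ ≤ η / (2 * q + 3)) ∧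
      (C.card : ℝ) ≤ (1 + Cq q * K / (2 * η)) ^ Module.finrank ℝ E := by
  obtain ⟨C, h1, h2, h3⟩ := exists_net_closedBall_mul (E := E) hB ha
    (by positivity : 0 < η / (2 * q + 3))
  refine ⟨C, h1, h2, h3.trans ?_⟩
  have h4 : Cq q * K / (2 * η) = 2 * K / (η / (2 * q + 3)) := by
    unfold Cq
    field_simp
    ring
  rw [h4]
  gcongr

theorem finrank_matrix_fintype {m n : Type*} [Fintype m] [Fintype n] :
    Module.finrank ℝ (Matrix m n ℝ) = Fintype.card m * Fintype.card n := by
  have := Module.finrank_matrix ℝ ℝ m n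
  rwa [Module.finrank_self, mul_one] at this

/-- Take the product of the nets of all blocks. The readout and `v` have their cost bounded by `K₁`,
all other blocks by `K₂`, and the exponents are the total dimensions of the two groups. The net
points obey the norm bounds, so the cover lies inside the class. -/
theorem IsStable.exists_cover (hs : IsStable c ρ s) (hq : 1 ≤ q) {η : ℝ} (hη : 0 < η) :
    ∃ P : Finset (X → ℝ), (P : Set (X → ℝ)) ⊆ readoutClass c s ∧
      (∀ f ∈ readoutClass c s, ∃ g ∈ P, ∀ x, |f x - g x| ≤ η) ∧
      (P.card : ℝ) ≤ (1 + Cq q * c.K₁ q ρ / (2 * η)) ^ (2 * p) *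
        (1 + Cq q * c.K₂ q ρ / (2 * η)) ^ ((q - 1) * p * (1 + p) + d * p * (2 + p)) := by
  classical
  have hA := c.CA_nonneg q hs.nonneg
  have hb := c.Cb_nonneg q
  have hU := c.CU_nonneg q
  have hv := c.Cv_nonneg q
  have kΦ : c.BΦ * ρ ≤ c.K₁ q ρ := le_max_left _ _
  have kv : c.Bv * c.Cv q ≤ c.K₁ q ρ := le_max_right _ _
  have kb : c.Bb * c.Cb q ≤ c.K₂ q ρ := (le_max_left _ _).trans (le_max_left _ _)
  have kA : c.BA * c.CA q ρ ≤ c.K₂ q ρ := (le_max_right _ _).trans (le_max_left _ _)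
  have kU : c.BU * c.CU q ≤ c.K₂ q ρ := le_max_right _ _
  obtain ⟨NΦ, Φ1, Φ2, Φ3⟩ := exists_net_of_mul_le (E := EuclideanSpace ℝ (Fin p)) c.BΦ.2
    hs.nonneg hη kΦ q
  obtain ⟨Nv, v1, v2, v3⟩ := exists_net_of_mul_le (E := EuclideanSpace ℝ (Fin p)) c.Bv.2 hv hη kv q
  obtain ⟨Nb, b1, b2, b3⟩ := exists_net_of_mul_le (E := EuclideanSpace ℝ (Fin p)) c.Bb.2 hb hη kb q
  obtain ⟨NA, A1, A2, A3⟩ :=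
    exists_net_of_mul_le (E := Matrix (Fin p) (Fin p) ℝ) c.BA.2 hA hη kA q
  obtain ⟨Nl, l1, l2, l3⟩ :=
    exists_net_of_mul_le (E := Matrix (Fin p × Fin d) (Fin p) ℝ) c.BA.2 hA hη kA q
  obtain ⟨Nβ, β1, β2, β3⟩ :=
    exists_net_of_mul_le (E := Matrix (Fin p) (Fin d) ℝ) c.Bb.2 hb hη kb q
  obtain ⟨NU, U1, U2, U3⟩ :=
    exists_net_of_mul_le (E := Matrix (Fin p) (Fin d) ℝ) c.BU.2 hU hη kU q
  rw [finrank_matrix_fintype] at A3 l3 β3 U3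
  rw [finrank_euclideanSpace_fin] at Φ3 v3 b3
  simp only [Fintype.card_prod, Fintype.card_fin] at A3 l3 β3 U3
  let N := NΦ ×ˢ Fintype.piFinset (fun _ : Fin (q - 1) => NA) ×ˢ
    Fintype.piFinset (fun _ : Fin (q - 1) => Nb) ×ˢ Nl ×ˢ Nβ ×ˢ NU ×ˢ Nv
  let toParams : EuclideanSpace ℝ (Fin p) × (Fin (q - 1) → Matrix (Fin p) (Fin p) ℝ) ×
      (Fin (q - 1) → EuclideanSpace ℝ (Fin p)) × Matrix (Fin p × Fin d) (Fin p) ℝ ×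
      Matrix (Fin p) (Fin d) ℝ × Matrix (Fin p) (Fin d) ℝ × EuclideanSpace ℝ (Fin p) →
      Params d p q := fun w => ⟨w.1, w.2.1, w.2.2.1, w.2.2.2.1, w.2.2.2.2.1, w.2.2.2.2.2.1,
        w.2.2.2.2.2.2⟩
  have hN : ∀ w ∈ N, toParams w ∈ paramSet d p q c := by
    rintro ⟨Φ, A, b, l, β, U, v⟩ hw
    simp only [N, Finset.mem_product, Fintype.mem_piFinset] at hw
    obtain ⟨h1, h2, h3, h4, h5, h6, h7⟩ := hw
    exact ⟨Φ1 _ h1, fun h => A1 _ (h2 h), fun h => b1 _ (h3 h), l1 _ h4, β1 _ h5, U1 _ h6,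
      v1 _ h7⟩
  refine ⟨N.image fun w x => inner ℝ (toParams w).readout (s (toParams w) x), ?_, ?_, ?_⟩
  · intro f hf
    obtain ⟨w, hw, rfl⟩ := Finset.mem_image.1 (Finset.mem_coe.1 hf)
    exact ⟨_, hN w hw, rfl⟩
  · rintro _ ⟨θ, hθ, rfl⟩
    obtain ⟨g1, g2, g3, g4, g5, g6, g7⟩ := id hθ
    obtain ⟨Φ, hΦ, hΦ'⟩ := Φ2 _ g1
    choose A hAm hA' using fun h => A2 _ (g2 h)
    choose b hbm hb' using fun h => b2 _ (g3 h)
    obtain ⟨l, hl, hl'⟩ := l2 _ g4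
    obtain ⟨β, hβ, hβ'⟩ := β2 _ g5
    obtain ⟨U, hU, hU'⟩ := U2 _ g6
    obtain ⟨v, hv, hv'⟩ := v2 _ g7
    have hw : (Φ, A, b, l, β, U, v) ∈ N := by
      simp only [N, Finset.mem_product, Fintype.mem_piFinset]
      exact ⟨hΦ, hAm, hbm, hl, hβ, hU, hv⟩
    refine ⟨_, Finset.mem_image_of_mem _ hw, fun x => ?_⟩
    refine (hs.abs_sub_le hq hθ (hN _ hw) x).trans ?_
    set δ := η / (2 * q + 3) with hδ
    have hsum : ∑ h, (c.CA q ρ * ‖θ.A h - A h‖ + c.Cb q * ‖θ.b h - b h‖) ≤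
        ∑ _h : Fin (q - 1), (δ + δ) := Finset.sum_le_sum fun h _ => add_le_add (hA' h) (hb' h)
    have hq' : ((q - 1 : ℕ) : ℝ) = q - 1 := by
      rw [Nat.cast_sub hq, Nat.cast_one]
    rw [Finset.sum_const, Finset.card_univ, Fintype.card_fin, nsmul_eq_mul, hq'] at hsum
    have hη' : η = (2 * q + 3) * δ := by rw [hδ]; field_simp
    change ρ * ‖θ.readout - Φ‖ + c.CU q * ‖θ.U - U‖ + c.Cv q * ‖θ.v - v‖ +
        (∑ h, (c.CA q ρ * ‖θ.A h - A h‖ + c.Cb q * ‖θ.b h - b h‖) +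
          (c.CA q ρ * ‖θ.Alast - l‖ + c.Cb q * ‖θ.blast - β‖)) ≤ η
    -- The budget is three blocks outside the field, `2 (q - 1)` hidden ones and two in the last
    -- layer, that is `2q + 3` shares `δ`.
    linarith
  · set x₁ := 1 + Cq q * c.K₁ q ρ / (2 * η) with hx₁
    set x₂ := 1 + Cq q * c.K₂ q ρ / (2 * η) with hx₂
    have hcard : ((N.image fun w x => inner ℝ (toParams w).readout (s (toParams w) x)).card : ℝ) ≤
        NΦ.card * (NA.card ^ (q - 1) * (Nb.card ^ (q - 1) * (Nl.card * (Nβ.card *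
          (NU.card * Nv.card))))) := by
      have : N.card = NΦ.card * (NA.card ^ (q - 1) * (Nb.card ^ (q - 1) * (Nl.card * (Nβ.card *
          (NU.card * Nv.card))))) := by
        simp [N, Finset.card_product]
      have h := Finset.card_image_le (s := N)
        (f := fun w x => inner ℝ (toParams w).readout (s (toParams w) x))
      rw [this] at h
      exact_mod_cast h
    have y₁ : 0 ≤ x₁ ^ p := (Nat.cast_nonneg _).trans Φ3
    have y₂ : 0 ≤ x₂ ^ p := (Nat.cast_nonneg _).trans b3
    have y₃ : 0 ≤ x₂ ^ (p * p) := (Nat.cast_nonneg _).trans A3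
    have y₄ : 0 ≤ x₂ ^ (p * d * p) := (Nat.cast_nonneg _).trans l3
    have y₅ : 0 ≤ x₂ ^ (p * d) := (Nat.cast_nonneg _).trans β3
    calc _ ≤ _ := hcard
      _ ≤ x₁ ^ p * ((x₂ ^ (p * p)) ^ (q - 1) * ((x₂ ^ p) ^ (q - 1) * (x₂ ^ (p * d * p) *
          (x₂ ^ (p * d) * (x₂ ^ (p * d) * x₁ ^ p))))) := by gcongr
      _ = (x₁ ^ p * x₁ ^ p) * ((x₂ ^ (p * p)) ^ (q - 1) * (x₂ ^ p) ^ (q - 1) * x₂ ^ (p * d * p) *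
          x₂ ^ (p * d) * x₂ ^ (p * d)) := by ring
      _ = _ := by
        rw [← pow_mul, ← pow_mul, ← pow_add, ← pow_add, ← pow_add, ← pow_add, ← pow_add]
        congr 2 <;> ring

theorem paramSet_nonempty (c : Bounds) : (paramSet d p q c).Nonempty :=
  ⟨⟨0, 0, 0, 0, 0, 0, 0⟩, by simp [paramSet]⟩

theorem supCoveringNumber_le_card {F : Set (X → ℝ)} {η : ℝ≥0} {P : Finset (X → ℝ)}
    (hP : (P : Set (X → ℝ)) ⊆ F) (hcov : ∀ f ∈ F, ∃ g ∈ P, ∀ x, |f x - g x| ≤ η) {B : ℝ}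
    (hB : (P.card : ℝ) ≤ B) : (supCoveringNumber F η : ℝ≥0∞) ≤ ENNReal.ofReal B := by
  have h1 : supCoveringNumber F η ≤ (P.card : ℕ∞) := by
    refine (Metric.IsCover.coveringNumber_le_encard (Set.image_mono hP) ?_).trans
      ((Set.encard_image_le _ _).trans (le_of_eq (Set.encard_coe_eq_coe_finsetCard P)))
    rintro _ ⟨f, hf, rfl⟩
    obtain ⟨g, hg, h⟩ := hcov f hf
    refine ⟨UniformFun.ofFun g, ⟨g, hg, rfl⟩, ?_⟩
    refine UniformFun.edist_le.2 fun x => ?_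
    rw [edist_dist, Real.dist_eq]
    refine (ENNReal.ofReal_le_ofReal (h x)).trans ?_
    rw [ENNReal.ofReal_coe_nnreal]
  have h2 : ENNReal.ofReal (P.card : ℝ) ≤ ENNReal.ofReal B := ENNReal.ofReal_le_ofReal hB
  rw [ENNReal.ofReal_natCast] at h2
  refine le_trans ?_ h2
  have h3 := ENat.toENNReal_le.2 h1
  simpa using h3

end Covering

/-! ### Explicit covering and Rademacher bounds -/

section Conclusion

variable {d p q : ℕ} {c : Bounds} {X : Type*} {ρ : ℝ}
  {s : Params d p q → X → EuclideanSpace ℝ (Fin p)}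

theorem Cq_pos (q : ℕ) : 0 < Cq q := by unfold Cq; positivity

theorem IsStable.K₁_nonneg (hs : IsStable c ρ s) : 0 ≤ c.K₁ q ρ :=
  (mul_nonneg c.BΦ.2 hs.nonneg).trans (le_max_left _ _)

theorem Bounds.K₂_nonneg (c : Bounds) (q : ℕ) (ρ : ℝ) : 0 ≤ c.K₂ q ρ :=
  (mul_nonneg c.BU.2 (c.CU_nonneg q)).trans (le_max_right _ _)

theorem covering_product_le (hd : 1 ≤ d) (hp : 1 ≤ p) {K₁ K₂ η : ℝ} (h₁ : 0 ≤ K₁) (h₂ : 0 ≤ K₂)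
    (hη : 0 < η) :
    (1 + Cq q * K₁ / (2 * η)) ^ (2 * p) *
      (1 + Cq q * K₂ / (2 * η)) ^ ((q - 1) * p * (1 + p) + d * p * (2 + p)) ≤
        coveringBound' d p q K₁ K₂ η := by
  have hC := Cq_pos q
  have hp' : (1 : ℝ) ≤ p := by exact_mod_cast hp
  have hdp' : (1 : ℝ) ≤ d * p := by exact_mod_cast Nat.mul_pos hd hp
  have e1 : 1 ≤ √(p : ℝ) := Real.one_le_sqrt.2 hp'
  have e2 : 1 ≤ √((d : ℝ) * p) := Real.one_le_sqrt.2 hdp'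
  have h0 : 0 ≤ Cq q * K₂ / (2 * η) := by positivity
  unfold coveringBound'
  rw [pow_add, ← mul_assoc]
  gcongr
  · exact le_mul_of_one_le_right h0 e1
  · exact le_mul_of_one_le_right h0 e2

/-- All bases are at least 1, so they may be enlarged by the square roots and by the maximum, and
exponents may grow. The factor `2p` is merged into the first exponent, using `2 p ≤ 2 p (1 + p)`. -/
theorem covering_product_le_max (hq : 1 ≤ q) (hd : 1 ≤ d) (hp : 1 ≤ p) {K₁ K₂ η : ℝ}
    (h₁ : 0 ≤ K₁) (h₂ : 0 ≤ K₂) (hη : 0 < η) :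
    (1 + Cq q * K₁ / (2 * η)) ^ (2 * p) *
      (1 + Cq q * K₂ / (2 * η)) ^ ((q - 1) * p * (1 + p) + d * p * (2 + p)) ≤
        coveringBound d p q (max K₁ K₂) K₂ η := by
  have hC := Cq_pos q
  have hp' : (1 : ℝ) ≤ p := by exact_mod_cast hp
  have hdp' : (1 : ℝ) ≤ d * p := by exact_mod_cast Nat.mul_pos hd hp
  have e1 : 1 ≤ √(p : ℝ) := Real.one_le_sqrt.2 hp'
  have e2 : 1 ≤ √((d : ℝ) * p) := Real.one_le_sqrt.2 hdp'
  have e3 : 1 ≤ √(p : ℝ) + √(d : ℝ) := e1.trans (le_add_of_nonneg_right (Real.sqrt_nonneg _))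
  set K := max K₁ K₂ with hK
  have hK0 : 0 ≤ K := h₁.trans (le_max_left _ _)
  have g1 : Cq q * K₁ / (2 * η) ≤ Cq q * K / (2 * η) := by
    have := le_max_left K₁ K₂
    gcongr
  have g2 : Cq q * K₂ / (2 * η) ≤ Cq q * K / (2 * η) := by
    have := le_max_right K₁ K₂
    gcongr
  have h0 : 0 ≤ Cq q * K / (2 * η) := by positivity
  have h0' : 0 ≤ Cq q * K₁ / (2 * η) := by positivity
  have h0'' : 0 ≤ Cq q * K₂ / (2 * η) := by positivity
  have f1 : 1 + Cq q * K₁ / (2 * η) ≤ 1 + Cq q * K / (2 * η) * √p :=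
    add_le_add le_rfl (g1.trans (le_mul_of_one_le_right h0 e1))
  have f2 : 1 + Cq q * K₂ / (2 * η) ≤ 1 + Cq q * K / (2 * η) * √p :=
    add_le_add le_rfl (g2.trans (le_mul_of_one_le_right h0 e1))
  have f3 : 1 + Cq q * K₂ / (2 * η) ≤ 1 + Cq q * K₂ / (2 * η) * (√p + √d) :=
    add_le_add le_rfl (le_mul_of_one_le_right h0'' e3)
  have f4 : 1 + Cq q * K₂ / (2 * η) ≤ 1 + Cq q * K / (2 * η) * √(d * p) :=
    add_le_add le_rfl (g2.trans (le_mul_of_one_le_right h0 e2))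
  obtain ⟨m, rfl⟩ := Nat.exists_eq_add_of_le' hq
  have x1 : 1 ≤ 1 + Cq (m + 1) * K / (2 * η) * √p := le_add_of_nonneg_right (by positivity)
  unfold coveringBound
  rw [Nat.add_sub_cancel]
  have e : m * p * (1 + p) + d * p * (2 + p) = m * p * (1 + p) + (2 * d * p + d * p ^ 2) := by ring
  rw [e, pow_add, pow_add]
  calc _ ≤ (1 + Cq (m + 1) * K / (2 * η) * √p) ^ (2 * p) *
        ((1 + Cq (m + 1) * K / (2 * η) * √p) ^ (m * p * (1 + p)) *
          ((1 + Cq (m + 1) * K₂ / (2 * η) * (√p + √d)) ^ (2 * d * p) *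
            (1 + Cq (m + 1) * K / (2 * η) * √(d * p)) ^ (d * p ^ 2))) := by gcongr
    _ = (1 + Cq (m + 1) * K / (2 * η) * √p) ^ (2 * p + m * p * (1 + p)) *
          (1 + Cq (m + 1) * K₂ / (2 * η) * (√p + √d)) ^ (2 * d * p) *
            (1 + Cq (m + 1) * K / (2 * η) * √(d * p)) ^ (d * p ^ 2) := by rw [pow_add]; ring
    _ ≤ _ := by
      gcongr
      nlinarith

theorem IsStable.supCoveringNumber_le (hs : IsStable c ρ s) (hd : 1 ≤ d) (hp : 1 ≤ p)
    (hq : 1 ≤ q) {η : ℝ≥0} (hη : 0 < η) :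
    (supCoveringNumber (readoutClass c s) η : ℝ≥0∞) ≤
        ENNReal.ofReal (coveringBound d p q (max (c.K₁ q ρ) (c.K₂ q ρ)) (c.K₂ q ρ) η) ∧
      (supCoveringNumber (readoutClass c s) η : ℝ≥0∞) ≤
        ENNReal.ofReal (coveringBound' d p q (c.K₁ q ρ) (c.K₂ q ρ) η) := by
  have hη' : (0 : ℝ) < η := hη
  obtain ⟨P, h1, h2, h3⟩ := hs.exists_cover hq hη'
  exact ⟨supCoveringNumber_le_card h1 h2
      (h3.trans (covering_product_le_max hq hd hp hs.K₁_nonneg (c.K₂_nonneg q ρ) hη')),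
    supCoveringNumber_le_card h1 h2
      (h3.trans (covering_product_le hd hp hs.K₁_nonneg (c.K₂_nonneg q ρ) hη'))⟩

/-- At the scale `M / 2 ^ j`, a factor of the covering bound is a power of `√n Cq K`. -/
theorem covering_factor_le {n : ℕ} {M K : ℝ} (hM : 0 < M) (hnM : 1 ≤ √n * M)
    (hK : 2 ≤ √n * Cq q * K) (j m : ℕ) :
    (1 + Cq q * K / (2 * (M / 2 ^ j))) ^ m ≤
      Real.exp (m * Real.log (√n * Cq q * K) * (j + 1)) := by
  set y := √n * Cq q * K with hy
  have hy0 : 0 < y := by linarith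
  have hCK : 0 ≤ Cq q * K := by
    by_contra! h
    have : y ≤ 0 := by
      rw [hy, mul_assoc]
      exact mul_nonpos_of_nonneg_of_nonpos (Real.sqrt_nonneg _) h.le
    linarith
  have h2j : (1 : ℝ) ≤ 2 ^ j := one_le_pow₀ one_le_two
  have h1 : Cq q * K / (2 * (M / 2 ^ j)) ≤ 2 ^ j * (y / 2) := by
    have h3 : Cq q * K / (2 * (M / 2 ^ j)) = 2 ^ j * (Cq q * K / (2 * M)) := by field_simp
    have h4 : Cq q * K / (2 * M) ≤ y / 2 := by
      rw [div_le_div_iff₀ (by positivity) two_pos, hy]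
      nlinarith
    rw [h3]
    gcongr
  -- The threshold `y ≥ 2` is used twice: to absorb the summand 1 into `2 ^ j * (y / 2)`, and to
  -- replace `2 ^ j` by `y ^ j`. This makes the entropy linear in `j`.
  have h5 : 1 + Cq q * K / (2 * (M / 2 ^ j)) ≤ y ^ (j + 1) := by
    have h6 : (2 : ℝ) ^ j ≤ y ^ j := pow_le_pow_left₀ two_pos.le hK j
    calc _ ≤ 2 ^ j * (y / 2) + 2 ^ j * (y / 2) := by
          have : 1 * 1 ≤ (2 : ℝ) ^ j * (y / 2) := mul_le_mul h2j (by linarith) one_pos.le (by positivity)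
          linarith
      _ = 2 ^ j * y := by ring
      _ ≤ y ^ j * y := by gcongr
      _ = _ := (pow_succ y j).symm
  have h7 : 0 ≤ 1 + Cq q * K / (2 * (M / 2 ^ j)) := by positivity
  have h8 : Real.exp (m * Real.log y * (j + 1)) = (y ^ (j + 1)) ^ m := by
    rw [← pow_mul, ← Real.exp_log hy0, ← Real.exp_nat_mul, Real.log_exp]
    push_cast
    ring_nf
  rw [h8]
  gcongr

theorem IsStable.empiricalRademacher_le (hs : IsStable c ρ s) (hd : 1 ≤ d) (hp : 1 ≤ p)
    (hq : 1 ≤ q) {n : ℕ} (S : Fin n → X) (hnM : 1 ≤ √n * (c.BΦ * ρ))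
    (hK₂ : 2 ≤ √n * Cq q * c.K₂ q ρ) :
    empiricalRademacher (readoutClass c s) S ≤ rademacherBound d p q n (c.BΦ * ρ)
        (max (c.K₁ q ρ) (c.K₂ q ρ)) (c.K₂ q ρ) ∧
      empiricalRademacher (readoutClass c s) S ≤ rademacherBound' d p q n (c.BΦ * ρ)
        (c.K₁ q ρ) (c.K₂ q ρ) := by
  set M := c.BΦ * ρ with hM
  set K₁ := c.K₁ q ρ with hK₁
  set K₂ := c.K₂ q ρ with hK₂'
  have hn : 0 < n := by
    rcases Nat.eq_zero_or_pos n with rfl | h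
    · norm_num at hnM
    · exact h
  have hn0 : 0 < √(n : ℝ) := by positivity
  have hM0 : 0 < M := by
    by_contra! h
    linarith [mul_nonpos_of_nonneg_of_nonpos hn0.le h]
  have hC := Cq_pos q
  have hMK : M ≤ K₁ := le_max_left _ _
  have hK₁0 : 0 < K₁ := hM0.trans_le hMK
  have hK₂0 : 0 < K₂ := by
    refine (c.K₂_nonneg q ρ).lt_of_ne fun h => ?_
    rw [hK₂', ← h, mul_zero] at hK₂
    norm_num at hK₂
  have hC12 : 12 ≤ Cq q := by
    unfold Cq
    have : (0 : ℝ) ≤ q := by positivity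
    linarith
  -- No separate threshold for `K₁` is required: `K₁ ≥ M`, `√n M ≥ 1` and `Cq q ≥ 12`.
  have hK₁2 : 2 ≤ √n * Cq q * K₁ := by
    have h1 : 1 ≤ √n * K₁ := hnM.trans (by gcongr)
    have h2 : 12 * 1 ≤ Cq q * (√n * K₁) := mul_le_mul hC12 h1 one_pos.le hC.le
    linarith
  set l₁ := Real.log (√n * Cq q * K₁) with hl₁
  set l₂ := Real.log (√n * Cq q * K₂) with hl₂
  have hl₁0 : 0 < l₁ := Real.log_pos (by linarith)
  have hl₂0 : 0 < l₂ := Real.log_pos (by linarith)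
  have hp' : (1 : ℝ) ≤ p := by exact_mod_cast hp
  have hd' : (1 : ℝ) ≤ d := by exact_mod_cast hd
  obtain ⟨m₁, hm₁⟩ : ∃ m, m = 2 * p := ⟨_, rfl⟩
  obtain ⟨m₂, hm₂⟩ : ∃ m, m = (q - 1) * p * (1 + p) + d * p * (2 + p) := ⟨_, rfl⟩
  have hm₁' : (m₁ : ℝ) = 2 * p := by rw [hm₁]; push_cast; ring
  have hm₂' : (m₂ : ℝ) = ((q : ℝ) - 1) * p * (1 + p) + d * p * (2 + p) := by
    rw [hm₂]; push_cast [Nat.cast_sub hq]; ring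
  set W := m₁ * l₁ + m₂ * l₂ with hW
  have hW0 : 0 < W := by
    have : (0 : ℝ) < m₁ := by rw [hm₁']; positivity
    positivity
  have main : empiricalRademacher (readoutClass c s) S ≤ 21 / 2 * M / √n * √W := by
    refine empiricalRademacher_le_of_linear_entropy ((paramSet_nonempty c).image _) hn S hM0 hW0
      (fun f hf => hs.abs_le hf) fun j => ?_
    obtain ⟨P, -, h2, h3⟩ := hs.exists_cover hq (by positivity : 0 < M / 2 ^ j)
    refine ⟨P, h3.trans ?_, h2⟩
    rw [← hm₁, ← hm₂, hW, add_mul, Real.exp_add]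
    have f1 := covering_factor_le hM0 hnM hK₁2 j m₁
    have f2 := covering_factor_le hM0 hnM hK₂ j m₂
    exact mul_le_mul f1 f2 (by positivity) (Real.exp_pos _).le
  have hlog : ∀ {a b K : ℝ}, 0 < a → 0 < K → a ≤ b →
      Real.log (√a * Cq q * K) ≤ Real.log (√b * Cq q * K) := fun {a b K} ha hK hab => by
    refine Real.log_le_log (by positivity) ?_
    gcongr
  have hn' : (0 : ℝ) < n := by exact_mod_cast hn
  have hq' : (0 : ℝ) ≤ (q : ℝ) - 1 := by
    have : (1 : ℝ) ≤ q := by exact_mod_cast hq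
    linarith
  have hU₂ : l₂ ≤ U₂ p q n K₂ := hlog hn' hK₂0 (le_mul_of_one_le_right hn'.le hp')
  have hU₃ : l₂ ≤ U₃ d p q n K₂ := hlog hn' hK₂0 (by
    rw [mul_assoc]
    exact le_mul_of_one_le_right hn'.le (one_le_mul_of_one_le_of_one_le hd' hp'))
  have hu₁ : l₁ ≤ U₁ q n (max K₁ K₂) := Real.log_le_log (by positivity)
    (by have := le_max_left K₁ K₂; gcongr)
  have hu₂ : l₂ ≤ U₁ q n (max K₁ K₂) := Real.log_le_log (by positivity)
    (by have := le_max_right K₁ K₂; gcongr)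
  have finish : ∀ V, W ≤ V → 21 / 2 * M / √n * √W ≤ 4 / n + 24 * M / √n * √V := by
    intro V hV
    have h1 : 21 / 2 * M / √n * √W ≤ 24 * M / √n * √V := by
      gcongr
      norm_num
    have h2 : (0 : ℝ) ≤ 4 / n := by positivity
    linarith
  refine ⟨main.trans (finish _ ?_), main.trans (finish _ ?_)⟩
  · rw [hW, hm₁', hm₂']
    have g1 : 2 * (p : ℝ) * l₁ ≤ 2 * p * U₁ q n (max K₁ K₂) := by gcongr
    have g2 : ((q : ℝ) - 1) * p * (1 + p) * l₂ ≤
        ((q : ℝ) - 1) * p * (1 + p) * U₁ q n (max K₁ K₂) := by gcongr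
    have g3 : 2 * (d : ℝ) * p * l₂ ≤ 2 * d * p * U₂ p q n K₂ := by gcongr
    have g4 : (d : ℝ) * p ^ 2 * l₂ ≤ d * p ^ 2 * U₃ d p q n K₂ := by gcongr
    -- The coefficient `(q + 1) p (p + 1)` exceeds `2 p + (q - 1) p (1 + p)` by exactly `2 p²`, and
    -- the surplus multiplies a nonnegative logarithm.
    have g5 : 0 ≤ 2 * (p : ℝ) ^ 2 * U₁ q n (max K₁ K₂) :=
      mul_nonneg (by positivity) (hl₁0.le.trans hu₁)
    linarith
  · rw [hW, hm₁', hm₂']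
    have g2 : ((q : ℝ) - 1) * p * (1 + p) * l₂ ≤ ((q : ℝ) - 1) * p * (1 + p) * U₂ p q n K₂ := by
      gcongr
    have g3 : (d : ℝ) * p * (2 + p) * l₂ ≤ d * p * (2 + p) * U₃ d p q n K₂ := by gcongr
    have g1 : U₁ q n K₁ = l₁ := rfl
    rw [g1]
    linarith

theorem isStable_resNetState (hq : 1 ≤ q) {σ : ℝ → ℝ} (hσ : LipschitzWith c.Lσ σ)
    (hσ0 : σ 0 = 0) {K : ℕ} (D : Grid K) :
    IsStable c (c.radiusD q D)
      fun (θ : Params d p q) (y : SeriesInput d c D) => θ.resNetState σ y.1 where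
  nonneg := c.radiusD_nonneg q D
  norm_le _ hθ := norm_resNetState_le hq hσ hσ0 D hθ
  norm_sub_le _ hθ _ hθ' := norm_resNetState_sub_le hq hσ hσ0 D hθ hθ'

theorem isStable_trajectory (hq : 1 ≤ q) {σ : ℝ → ℝ} (hσ : LipschitzWith c.Lσ σ)
    (hσ0 : σ 0 = 0) :
    IsStable c (c.radius q)
      fun (θ : Params d p q) (x : PathInput d c) => θ.trajectory σ x.1 1 where
  nonneg := c.radius_nonneg q
  norm_le _ hθ := norm_trajectory_le hq hσ hσ0 hθ
  norm_sub_le _ hθ _ hθ' := norm_trajectory_sub_le hq hσ hσ0 hθ hθ'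

end Conclusion

end NCDE

theorem proposition1 {d p q K : ℕ} (hd : 1 ≤ d) (hp : 1 ≤ p) (hq : 1 ≤ q)
    (c : NCDE.Bounds) (σ : ℝ → ℝ) (hσ : LipschitzWith c.Lσ σ) (hσ0 : σ 0 = 0)
    (D : NCDE.Grid K) :
    -- discretized inputs
    ((∀ f ∈ NCDE.resNetClass d p q σ c D, ∀ y, |f y| ≤ c.MD q D) ∧
      (∀ η : ℝ≥0, 0 < η →
        (NCDE.supCoveringNumber (NCDE.resNetClass d p q σ c D) η : ℝ≥0∞) ≤
            ENNReal.ofReal (NCDE.coveringBound d p q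
              (max (c.K₁ q (c.radiusD q D)) (c.K₂ q (c.radiusD q D)))
              (c.K₂ q (c.radiusD q D)) η) ∧
        (NCDE.supCoveringNumber (NCDE.resNetClass d p q σ c D) η : ℝ≥0∞) ≤
            ENNReal.ofReal (NCDE.coveringBound' d p q
              (c.K₁ q (c.radiusD q D)) (c.K₂ q (c.radiusD q D)) η)) ∧
      (∀ (n : ℕ) (S : Fin n → NCDE.SeriesInput d c D),
        1 ≤ √n * c.MD q D → 2 ≤ √n * NCDE.Cq q * c.K₂ q (c.radiusD q D) →
        NCDE.empiricalRademacher (NCDE.resNetClass d p q σ c D) S ≤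
            NCDE.rademacherBound d p q n (c.MD q D)
              (max (c.K₁ q (c.radiusD q D)) (c.K₂ q (c.radiusD q D)))
              (c.K₂ q (c.radiusD q D)) ∧
        NCDE.empiricalRademacher (NCDE.resNetClass d p q σ c D) S ≤
            NCDE.rademacherBound' d p q n (c.MD q D)
              (c.K₁ q (c.radiusD q D)) (c.K₂ q (c.radiusD q D)))) ∧
    -- continuous inputs: the same bounds, with constants that do not involve the grid
    ((∀ θ : NCDE.Params d p q, ∀ x : NCDE.PathInput d c,
        ∃ z, θ.IsSolution σ x.1 z ∧
          ∀ w, θ.IsSolution σ x.1 w → Set.EqOn w z (Set.Icc 0 1)) ∧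
      (∀ f ∈ NCDE.ncdeClass d p q σ c, ∀ x, |f x| ≤ c.M q) ∧
      (∀ η : ℝ≥0, 0 < η →
        (NCDE.supCoveringNumber (NCDE.ncdeClass d p q σ c) η : ℝ≥0∞) ≤
            ENNReal.ofReal (NCDE.coveringBound d p q
              (max (c.K₁ q (c.radius q)) (c.K₂ q (c.radius q))) (c.K₂ q (c.radius q)) η) ∧
        (NCDE.supCoveringNumber (NCDE.ncdeClass d p q σ c) η : ℝ≥0∞) ≤
            ENNReal.ofReal (NCDE.coveringBound' d p q
              (c.K₁ q (c.radius q)) (c.K₂ q (c.radius q)) η)) ∧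
      (∀ (n : ℕ) (S : Fin n → NCDE.PathInput d c),
        1 ≤ √n * c.M q → 2 ≤ √n * NCDE.Cq q * c.K₂ q (c.radius q) →
        NCDE.empiricalRademacher (NCDE.ncdeClass d p q σ c) S ≤
            NCDE.rademacherBound d p q n (c.M q)
              (max (c.K₁ q (c.radius q)) (c.K₂ q (c.radius q))) (c.K₂ q (c.radius q)) ∧
        NCDE.empiricalRademacher (NCDE.ncdeClass d p q σ c) S ≤
            NCDE.rademacherBound' d p q n (c.M q)
              (c.K₁ q (c.radius q)) (c.K₂ q (c.radius q)))) := by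
  have hD := NCDE.isStable_resNetState (d := d) (p := p) hq hσ hσ0 D
  have hc := NCDE.isStable_trajectory (d := d) (p := p) hq hσ hσ0
  refine ⟨⟨fun f hf y => hD.abs_le hf y, fun η hη => hD.supCoveringNumber_le hd hp hq hη,
      fun n S h1 h2 => hD.empiricalRademacher_le hd hp hq S h1 h2⟩,
    fun θ x => ?_, fun f hf x => hc.abs_le hf x, fun η hη => hc.supCoveringNumber_le hd hp hq hη,
      fun n S h1 h2 => hc.empiricalRademacher_le hd hp hq S h1 h2⟩
  obtain ⟨z, hz, huniq, -⟩ := NCDE.exists_isSolution hq hσ hσ0 θ x.2.1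
  exact ⟨z, hz, huniq⟩
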